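/- Conventions. Let $Y$ be a real vector space (of any dimension) and let $\Omega\subseteq Y$ be a nonempty convex set such that every straight line $\ell_{xy}$ through two distinct points $x,y\in\Omega$ meets $\Omega$ in an open and bounded segment of $\ell_{xy}$. Hilbert's metric on $\Omega$ is given by $\delta_H(x,x)=0$ and, for $x\neq y$, $$\delta_H(x,y)=\log\left(\frac{|x'-y|}{|x'-x|}\,\frac{|y'-x|}{|y'-y|}\right),$$ where $x',y'$ are the end-points of $\ell_{xy}\cap\Omega$, with $x$ between $x'$ and $y$, and $y$ between $x$ and $y'$. The metric space $(\Omega,\delta_H)$ is called a Hilbert geometry. To $\Omega$ one associates the following order unit space. Let $X$ be the linear span of $\Omega\times\{1\}$ in $Y\oplus\mathbb R$, let $\overline\Omega$ be the set of $y\in Y$ such that $(1-t)x+ty\in\Omega$ for all $x\in\Omega$ and $0<t<1$, and put $$C=\{\lambda(y,1):\lambda\ge 0,\ y\in\overline\Omega\},\qquad u=(p,1)\ \text{ for a chosen point } p\in\Omega,\qquad \varphi(y,s)=s .$$ Then $C$ is an Archimedean cone in $X$ with order unit $u$, and $\varphi$ is a strictly positive state. Equip $X$ with the order unit norm $\|x\|_u=\inf\{\lambda>0: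 \lambda u+x\in C,\ \lambda u-x\in C\}$, and let $C^\circ$ be the interior of $C$. The map $x\mapsto (x,1)$ identifies $\Omega$ with $\Sigma=\{z\in C^\circ:\varphi(z)=1\}$. Let $\partial\Sigma$ be the boundary of $\Sigma$ relative to the affine space $\{z\in X:\varphi(z)=1\}$. The Hilbert geometry on $\Omega$ is strictly convex if for all distinct $a,b\in\partial\Sigma$ the open segment between $a$ and $b$ is contained in $\Sigma$. Theorem. Let $(\Omega_1,\delta_H)$ and $(\Omega_2,\delta_H)$ be strictly convex Hilbert geometries, possibly infinite dimensional, with associated spaces $(X_i,C_i,u_i,\varphi_i)$, $i=1,2$. Let $f\colon\Omega_1\to\Omega_2$ be an isometry of $(\Omega_1,\delta_H)$ into $(\Omega_2,\delta_H)$, not necessarily surjective. Then $f$ is a projective linear homomorphism. That is, there exists a linear map $T\colon X_1\to X_2$ which is bi-positive (for $z\in X_1$: $Tz\in C_2$ if and only if $z\in C_1$) such that $$(f(x),1)=\frac{T(x,1)}{\varphi_2(T(x,1))}\qquad\text{for all }x\in\Omega_1 .$$ -/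

import Mathlib

/-! ### Order unit spaces -/

/-- The structure of an order unit space on a real vector space `X`: an Archimedean cone `C`
(convex, closed under multiplication by nonnegative scalars, `C ∩ -C = {0}`)
with an order unit `u`.  The order is `x ≤ y ↔ y - x ∈ C`. -/
structure OrderUnitSpace (X : Type*) [AddCommGroup X] [Module ℝ X] where
  cone : PointedCone ℝ X
  unit : X
  salient : ∀ x, x ∈ cone → -x ∈ cone → x = 0
  archimedean : ∀ x, ∀ y ∈ cone, (∀ n : ℕ, 1 ≤ n → y - (n : ℝ) • x ∈ cone) → -x ∈ cone
  unit_mem : unit ∈ cone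
  orderUnit : ∀ x, ∃ r : ℝ, 0 < r ∧ r • unit - x ∈ cone

namespace OrderUnitSpace

variable {X : Type*} [AddCommGroup X] [Module ℝ X]
variable {X' : Type*} [AddCommGroup X'] [Module ℝ X']

/-- The order unit norm `‖x‖_u = inf {r > 0 : -r u ≤ x ≤ r u}`. -/
noncomputable def norm (V : OrderUnitSpace X) (x : X) : ℝ :=
  sInf {r : ℝ | 0 < r ∧ x + r • V.unit ∈ V.cone ∧ r • V.unit - x ∈ V.cone}

/-- The interior of the cone for the order unit norm. -/
def interior (V : OrderUnitSpace X) : Set X :=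
  {x | ∃ ε : ℝ, 0 < ε ∧ ∀ y, V.norm (y - x) < ε → y ∈ V.cone}

/-- `φ` is a strictly positive state. -/
structure IsStrictlyPositiveState (V : OrderUnitSpace X) (φ : X →ₗ[ℝ] ℝ) : Prop where
  pos : ∀ x ∈ V.cone, x ≠ 0 → 0 < φ x
  map_unit : φ V.unit = 1

/-- The cross section `Σ_φ = {x ∈ C° : φ x = 1}`. -/
def crossSection (V : OrderUnitSpace X) (φ : X →ₗ[ℝ] ℝ) : Set X :=
  {x | x ∈ V.interior ∧ φ x = 1}

/-- The boundary of `Σ_φ` relative to the affine space `{x : φ x = 1}` with the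
order unit norm. -/
def boundary (V : OrderUnitSpace X) (φ : X →ₗ[ℝ] ℝ) : Set X :=
  {x | φ x = 1 ∧ ∀ ε : ℝ, 0 < ε →
    (∃ y, y ∈ V.crossSection φ ∧ V.norm (y - x) < ε) ∧
    (∃ z, φ z = 1 ∧ z ∉ V.crossSection φ ∧ V.norm (z - x) < ε)}

/-- `Σ_φ` is strictly convex: the open segment between two distinct boundary points lies
in `Σ_φ`. -/
def IsStrictlyConvex (V : OrderUnitSpace X) (φ : X →ₗ[ℝ] ℝ) : Prop :=
  ∀ x ∈ V.boundary φ, ∀ y ∈ V.boundary φ, x ≠ y → openSegment ℝ x y ⊆ V.crossSection φ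

/-- A linear map is bi-positive if `T x ∈ C' ↔ x ∈ C`. -/
def BiPositive (V : OrderUnitSpace X) (V' : OrderUnitSpace X') (T : X →ₗ[ℝ] X') : Prop :=
  ∀ x, T x ∈ V'.cone ↔ x ∈ V.cone

end OrderUnitSpace

/-! ### Hilbert's metric on convex sets -/

/-- A nonempty convex set on which Hilbert's metric is well defined: every straight line through
two distinct points of `Ω` meets `Ω` in an open and bounded line segment.  (Openness and
boundedness are those of the line, whose points are `x + t (y - x)` with `t ∈ ℝ`.) -/
structure IsHilbertDomain {Y : Type*} [AddCommGroup Y] [Module ℝ Y] (Ω : Set Y) : Prop where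
  nonempty : Ω.Nonempty
  convex : Convex ℝ Ω
  isOpen_line : ∀ x ∈ Ω, ∀ y ∈ Ω, x ≠ y → IsOpen {t : ℝ | AffineMap.lineMap x y t ∈ Ω}
  isBounded_line : ∀ x ∈ Ω, ∀ y ∈ Ω, x ≠ y →
    Bornology.IsBounded {t : ℝ | AffineMap.lineMap x y t ∈ Ω}

open Classical in
/-- Hilbert's metric: `log [x', x, y, y']` for `x ≠ y`, where `x'` and `y'` are the
end-points of the line through `x` and `y` in `Ω` on the side of `x` and of `y`, and
`[x', x, y, y'] = (|x' - y| / |x' - x|) * (|y' - x| / |y' - y|)`.  In the affine coordinate `t`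
of the line, `x`, `y`, `x'`, `y'` are the points `0`, `1`, `a`, `b`. -/
noncomputable def hilbertDist {Y : Type*} [AddCommGroup Y] [Module ℝ Y] (Ω : Set Y)
    (x y : Y) : ℝ :=
  if x = y then 0 else
    let a := sInf {t : ℝ | AffineMap.lineMap x y t ∈ Ω}
    let b := sSup {t : ℝ | AffineMap.lineMap x y t ∈ Ω}
    Real.log (|a - 1| / |a - 0| * (|b - 0| / |b - 1|))

/-! ### The order unit space of a Hilbert geometry -/

section Homogenization

variable {Y : Type*} [AddCommGroup Y] [Module ℝ Y]

/-- The closure of `Ω`: all points `y` such that the segment from each point of `Ω` to `y`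
lies in `Ω`, except perhaps for `y`. -/
def lineClosure (Ω : Set Y) : Set Y :=
  {y | ∀ x ∈ Ω, openSegment ℝ x y ⊆ Ω}

/-- The linear span `X` of `Ω × {1}` in `Y ⊕ ℝ`.  When `0 ∈ Ω` and `Ω` spans `Y`, this is
all of `Y ⊕ ℝ`. -/
abbrev homogSpace (Ω : Set Y) : Submodule ℝ (Y × ℝ) :=
  Submodule.span ℝ {w | w.1 ∈ Ω ∧ w.2 = 1}

/-- The embedding `x ↦ (x, 1)` of `Ω` in `X`. -/
def homogEmbed {Ω : Set Y} (x : Ω) : homogSpace Ω :=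
  ⟨((x : Y), 1), Submodule.subset_span ⟨x.2, rfl⟩⟩

/-- The linear functional `(y, s) ↦ s` on `X`. -/
def homogState (Ω : Set Y) : homogSpace Ω →ₗ[ℝ] ℝ :=
  (LinearMap.snd ℝ Y ℝ).comp (homogSpace Ω).subtype

/-- `{r (y, 1) : r ≥ 0, y in the closure of Ω}` -/
def homogConeSet (Ω : Set Y) : Set (homogSpace Ω) :=
  {w | ∃ r : ℝ, 0 ≤ r ∧ ∃ y ∈ lineClosure Ω, (w : Y × ℝ) = r • (y, (1 : ℝ))}

theorem IsHilbertDomain.exists_extend {Ω : Set Y} (hΩ : IsHilbertDomain Ω) {x y : Y}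
    (hx : x ∈ Ω) (hy : y ∈ Ω) : ∃ ε : ℝ, 0 < ε ∧ y + ε • (y - x) ∈ Ω := by
  by_cases h : x = y
  · exact ⟨1, one_pos, by simpa [h] using hy⟩
  · have h1 : (1 : ℝ) ∈ {t : ℝ | AffineMap.lineMap x y t ∈ Ω} := by simpa using hy
    obtain ⟨ε, hε, hb⟩ := Metric.isOpen_iff.1 (hΩ.isOpen_line x hx y hy h) 1 h1
    refine ⟨ε / 2, by positivity, ?_⟩
    have h2 : (1 + ε / 2 : ℝ) ∈ Metric.ball (1 : ℝ) ε := by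
      rw [Metric.mem_ball, Real.dist_eq, add_sub_cancel_left, abs_of_pos (by positivity)]
      linarith
    have h3 := hb h2
    simp only [Set.mem_ofPred_eq, AffineMap.lineMap_apply_module'] at h3
    convert h3 using 1
    module

theorem IsHilbertDomain.subset_lineClosure {Ω : Set Y} (hΩ : IsHilbertDomain Ω) :
    Ω ⊆ lineClosure Ω := fun _ hy _ hx => hΩ.convex.openSegment_subset hx hy

theorem IsHilbertDomain.convex_lineClosure {Ω : Set Y} (hΩ : IsHilbertDomain Ω) :
    Convex ℝ (lineClosure Ω) := by
  rintro y hy z hz α β hα hβ hαβ x hx _ ⟨s, t, hs, ht, hst, rfl⟩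
  have h := hΩ.convex (hy x hx ⟨s, t, hs, ht, hst, rfl⟩) (hz x hx ⟨s, t, hs, ht, hst, rfl⟩)
    hα hβ hαβ
  convert h using 1
  obtain rfl : β = 1 - α := by linarith
  module

/-- The cone `C_Ω` in `X`. -/
def IsHilbertDomain.homogCone {Ω : Set Y} (hΩ : IsHilbertDomain Ω) :
    PointedCone ℝ (homogSpace Ω) where
  carrier := homogConeSet Ω
  add_mem' := by
    rintro v w ⟨r, hr, y, hy, hv⟩ ⟨s, hs, z, hz, hw⟩
    rcases (add_nonneg hr hs).eq_or_lt with h | h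
    · have hr0 : r = 0 := by linarith
      have hs0 : s = 0 := by linarith
      exact ⟨0, le_rfl, y, hy, by simp [hv, hw, hr0, hs0]⟩
    · refine ⟨r + s, h.le, (r / (r + s)) • y + (s / (r + s)) • z,
        hΩ.convex_lineClosure hy hz (by positivity) (by positivity) (by field_simp), ?_⟩
      rw [Submodule.coe_add, hv, hw]
      ext
      · simp only [Prod.fst_add, Prod.smul_fst, smul_add, smul_smul]
        rw [mul_div_cancel₀ _ h.ne', mul_div_cancel₀ _ h.ne']
      · simp
  zero_mem' := by
    obtain ⟨p, hp⟩ := hΩ.nonempty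
    exact ⟨0, le_rfl, p, hΩ.subset_lineClosure hp, by simp⟩
  smul_mem' := by
    rintro ⟨c, hc⟩ w ⟨r, hr, y, hy, hw⟩
    refine ⟨c * r, mul_nonneg hc hr, y, hy, ?_⟩
    change c • (w : Y × ℝ) = _
    rw [hw, smul_smul]

theorem IsHilbertDomain.mem_homogCone {Ω : Set Y} (hΩ : IsHilbertDomain Ω) {w : homogSpace Ω} :
    w ∈ hΩ.homogCone ↔
      ∃ r : ℝ, 0 ≤ r ∧ ∃ y ∈ lineClosure Ω, (w : Y × ℝ) = r • (y, (1 : ℝ)) := Iff.rfl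

theorem IsHilbertDomain.smul_mem_homogCone {Ω : Set Y} (hΩ : IsHilbertDomain Ω)
    {w : homogSpace Ω} (hw : w ∈ hΩ.homogCone) {c : ℝ} (hc : 0 ≤ c) : c • w ∈ hΩ.homogCone :=
  hΩ.homogCone.smul_mem hc hw

theorem IsHilbertDomain.homogEmbed_mem {Ω : Set Y} (hΩ : IsHilbertDomain Ω) (x : Ω) :
    homogEmbed x ∈ hΩ.homogCone :=
  ⟨1, zero_le_one, x, hΩ.subset_lineClosure x.2, by simp [homogEmbed]⟩

theorem IsHilbertDomain.exists_sub_smul_mem {Ω : Set Y} (hΩ : IsHilbertDomain Ω) (p x : Ω) :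
    ∃ δ : ℝ, 0 < δ ∧ homogEmbed x - δ • homogEmbed p ∈ hΩ.homogCone := by
  obtain ⟨ε, hε, h⟩ := hΩ.exists_extend p.2 x.2
  have h1 : (1 + ε) ≠ 0 := by positivity
  refine ⟨ε / (1 + ε), by positivity, 1 / (1 + ε), by positivity, _,
    hΩ.subset_lineClosure h, ?_⟩
  ext
  · simp only [homogEmbed, Submodule.coe_sub, Submodule.coe_smul, Prod.fst_sub, Prod.smul_fst]
    have : (x : Y) = ((1 / (1 + ε)) * (1 + ε)) • (x : Y) := by
      rw [one_div_mul_cancel h1, one_smul]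
    conv_lhs => rw [this]
    module
  · simp [homogEmbed]
    field_simp
    ring

theorem IsHilbertDomain.exists_unit_bound {Ω : Set Y} (hΩ : IsHilbertDomain Ω) (p : Ω)
    (w : homogSpace Ω) : ∃ r : ℝ, 0 < r ∧ r • homogEmbed p + w ∈ hΩ.homogCone ∧
      r • homogEmbed p - w ∈ hΩ.homogCone := by
  obtain ⟨w, hw⟩ := w
  induction hw using Submodule.span_induction with
  | mem w hw =>
    obtain ⟨y, s⟩ := w
    obtain ⟨hy, rfl⟩ : y ∈ Ω ∧ s = 1 := hw
    obtain ⟨δ, hδ, h⟩ := hΩ.exists_sub_smul_mem ⟨y, hy⟩ p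
    have h' := hΩ.smul_mem_homogCone h (inv_nonneg.2 hδ.le)
    rw [smul_sub, smul_smul, inv_mul_cancel₀ hδ.ne', one_smul] at h'
    exact ⟨δ⁻¹, inv_pos.2 hδ, add_mem
      (hΩ.smul_mem_homogCone (hΩ.homogEmbed_mem p) (inv_nonneg.2 hδ.le))
      (hΩ.homogEmbed_mem ⟨y, hy⟩), h'⟩
  | zero =>
    have h := hΩ.homogEmbed_mem p
    refine ⟨1, one_pos, ?_, ?_⟩
    · convert h using 1
      ext <;> simp
    · convert h using 1
      ext <;> simp
  | add v w hv hw ihv ihw =>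
    obtain ⟨r, hr, h1, h2⟩ := ihv
    obtain ⟨s, hs, h3, h4⟩ := ihw
    refine ⟨r + s, add_pos hr hs, ?_, ?_⟩
    · convert add_mem h1 h3 using 1
      ext <;> simp [add_smul] <;> abel
    · convert add_mem h2 h4 using 1
      ext <;> simp [add_smul] <;> abel
  | smul c w hw ih =>
    obtain ⟨r, hr, h1, h2⟩ := ih
    have hu := hΩ.homogEmbed_mem p
    rcases le_total 0 c with hc | hc
    · refine ⟨c * r + 1, by positivity, ?_, ?_⟩
      · convert add_mem (hΩ.smul_mem_homogCone h1 hc) hu using 1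
        ext <;> simp [add_smul, mul_smul] <;> abel
      · convert add_mem (hΩ.smul_mem_homogCone h2 hc) hu using 1
        ext
        · simp [add_smul, mul_smul, smul_sub]; abel
        · simp; ring
    · have hc' : 0 ≤ -c := by linarith
      refine ⟨-c * r + 1, by positivity, ?_, ?_⟩
      · convert add_mem (hΩ.smul_mem_homogCone h2 hc') hu using 1
        ext
        · simp [add_smul, mul_smul, smul_sub]; abel
        · simp; ring
      · convert add_mem (hΩ.smul_mem_homogCone h1 hc') hu using 1
        ext
        · simp [add_smul, mul_smul]; abel
        · simp; ring

theorem IsHilbertDomain.homogCone_archimedean {Ω : Set Y} (hΩ : IsHilbertDomain Ω) (p : Ω)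
    (x : homogSpace Ω)
    (h : ∀ ε : ℝ, 0 < ε → ε • homogEmbed p - x ∈ hΩ.homogCone) : -x ∈ hΩ.homogCone := by
  obtain ⟨⟨a, s⟩, hx⟩ := x
  have key : ∀ ε : ℝ, 0 < ε → ∃ y ∈ lineClosure Ω, 0 ≤ ε - s ∧
      ε • (p : Y) - a = (ε - s) • y := by
    intro ε hε
    obtain ⟨r, hr, y, hy, he⟩ := hΩ.mem_homogCone.1 (h ε hε)
    have h1 : ε • (p : Y) - a = r • y := by simpa [homogEmbed] using congrArg Prod.fst he
    have h2 : ε - s = r := by simpa [homogEmbed] using congrArg Prod.snd he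
    exact ⟨y, hy, by rw [h2]; exact hr, by rw [h2]; exact h1⟩
  have hs : s ≤ 0 := by
    by_contra hs
    push Not at hs
    obtain ⟨y, -, h1, -⟩ := key (s / 2) (by positivity)
    linarith
  rcases hs.eq_or_lt with rfl | hs
  · have ha : a = 0 := by
      by_contra ha
      have hmem : ∀ k : ℝ, 0 < k → (p : Y) - k • a ∈ Ω := by
        intro k hk
        obtain ⟨y, hy, -, h2⟩ := key (1 / (2 * k)) (by positivity)
        have h3 : a = (1 / (2 * k)) • ((p : Y) - y) := by
          rw [sub_zero] at h2
          rw [smul_sub, ← h2]; abel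
        refine hy p p.2 ⟨1 / 2, 1 / 2, by norm_num, by norm_num, by norm_num, ?_⟩
        rw [h3, smul_smul]
        have : k * (1 / (2 * k)) = 1 / 2 := by field_simp
        rw [this]
        module
      have hne : (p : Y) ≠ (p : Y) - (1 : ℝ) • a := by
        intro h0
        apply ha
        rw [one_smul, eq_comm, sub_eq_self] at h0
        exact h0
      obtain ⟨R, hR⟩ := (hΩ.isBounded_line p p.2 _ (hmem 1 one_pos) hne).bddAbove
      have hp : (0 : ℝ) < |R| + 1 := by positivity
      have : (|R| + 1) ∈ {t : ℝ | AffineMap.lineMap (p : Y) ((p : Y) - (1 : ℝ) • a) t ∈ Ω} := by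
        simp only [Set.mem_ofPred_eq, AffineMap.lineMap_apply_module']
        convert hmem _ hp using 1
        module
      have := hR this
      linarith [le_abs_self R]
    subst ha
    convert zero_mem hΩ.homogCone using 1
    ext <;> simp
  · refine ⟨-s, by linarith, s⁻¹ • a, ?_, ?_⟩
    · rintro q hq _ ⟨t', t, ht', ht, htt, rfl⟩
      obtain ⟨δ, hδ, hq'⟩ := hΩ.exists_extend p.2 hq
      have ht1 : t' = 1 - t := by linarith
      subst ht1
      set e : ℝ := (1 - t) * δ / (t * (1 + δ)) with he
      have hepos : 0 < e := by positivity
      obtain ⟨y, hy, -, h2⟩ := key (-s * e) (by nlinarith)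
      have hse : (-s * e - s) ≠ 0 := by nlinarith
      have hy' : y = (-s * e - s)⁻¹ • ((-s * e) • (p : Y) - a) := by
        rw [h2, smul_smul, inv_mul_cancel₀ hse, one_smul]
      have hr1 : t * (1 + e) = t + (1 - t) * δ / (1 + δ) := by
        rw [he]; field_simp
      have hr2 : 1 - t * (1 + e) = (1 - t) / (1 + δ) := by
        rw [hr1]; field_simp; ring
      have hmem := hy _ hq' ⟨1 - t * (1 + e), t * (1 + e), by rw [hr2]; positivity,
        by positivity, by ring, rfl⟩
      convert hmem using 1
      rw [hr2, hy']
      have c1 : t * (1 + e) * (-s * e - s)⁻¹ * (-s * e) = (1 - t) / (1 + δ) * δ := by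
        have : t * e = (1 - t) / (1 + δ) * δ := by rw [he]; field_simp
        rw [← this]
        have h1e : 1 + e ≠ 0 := by positivity
        have : -s * e - s = -s * (1 + e) := by ring
        rw [this]
        have := hs.ne
        field_simp
      have c2 : t * (1 + e) * (-s * e - s)⁻¹ = - (t * s⁻¹) := by
        have h1e : 1 + e ≠ 0 := by positivity
        have : -s * e - s = -s * (1 + e) := by ring
        rw [this]
        have := hs.ne
        field_simp
      have c3 : (1 - t) = (1 - t) / (1 + δ) * (1 + δ) := by field_simp
      have : (t * (1 + e)) • ((-s * e - s)⁻¹ • ((-s * e) • (p : Y) - a))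
          = ((1 - t) / (1 + δ) * δ) • (p : Y) + (t * s⁻¹) • a := by
        rw [smul_smul, smul_sub, smul_smul, c1, c2]
        module
      rw [this]
      conv_lhs => rw [c3]
      module
    · ext
      · simp [smul_smul, hs.ne]
      · simp

/-- The order unit space `(X, C_Ω, u)` of a Hilbert geometry, with `u = (p, 1)` for a point `p`
of `Ω`. -/
noncomputable def IsHilbertDomain.orderUnitSpace {Ω : Set Y} (hΩ : IsHilbertDomain Ω) :
    OrderUnitSpace (homogSpace Ω) where
  cone := hΩ.homogCone
  unit := homogEmbed ⟨hΩ.nonempty.some, hΩ.nonempty.some_mem⟩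
  salient := by
    rintro w ⟨r, hr, y, hy, h1⟩ ⟨s, hs, z, hz, h2⟩
    have e1 : (w : Y × ℝ).2 = r := by simpa using congrArg Prod.snd h1
    have e2 : -(w : Y × ℝ).2 = s := by simpa using congrArg Prod.snd h2
    have hr0 : r = 0 := by linarith
    apply Subtype.ext
    rw [h1, hr0]
    simp
  archimedean := by
    intro x y _ h
    refine hΩ.homogCone_archimedean ⟨hΩ.nonempty.some, hΩ.nonempty.some_mem⟩ x fun ε hε => ?_
    obtain ⟨r, hr, -, hry⟩ :=
      hΩ.exists_unit_bound ⟨hΩ.nonempty.some, hΩ.nonempty.some_mem⟩ y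
    obtain ⟨n, hn⟩ := exists_nat_gt (r / ε)
    have hn0 : (0 : ℝ) < n := lt_trans (by positivity) hn
    have hn1 : 1 ≤ n := by exact_mod_cast hn0
    have h1 := hΩ.smul_mem_homogCone (add_mem hry (h n hn1)) (inv_nonneg.2 hn0.le)
    have h2 : 0 ≤ ε - r / n := by
      rw [div_lt_iff₀ hε] at hn
      rw [sub_nonneg, div_le_iff₀ hn0]
      linarith
    convert add_mem h1 (hΩ.smul_mem_homogCone
      (hΩ.homogEmbed_mem ⟨hΩ.nonempty.some, hΩ.nonempty.some_mem⟩) h2) using 1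
    rw [sub_add_sub_cancel, smul_sub, smul_smul, smul_smul, inv_mul_cancel₀ hn0.ne',
      div_eq_inv_mul]
    module
  unit_mem := hΩ.homogEmbed_mem _
  orderUnit := fun x => by
    obtain ⟨r, hr, -, h⟩ := hΩ.exists_unit_bound ⟨hΩ.nonempty.some, hΩ.nonempty.some_mem⟩ x
    exact ⟨r, hr, h⟩

theorem IsHilbertDomain.isStrictlyPositiveState {Ω : Set Y} (hΩ : IsHilbertDomain Ω) :
    hΩ.orderUnitSpace.IsStrictlyPositiveState (homogState Ω) where
  pos := by
    rintro w ⟨r, hr, y, hy, h⟩ hw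
    have e : (w : Y × ℝ).2 = r := by simpa using congrArg Prod.snd h
    change 0 < (w : Y × ℝ).2
    rw [e]
    refine hr.lt_of_ne fun h0 => hw (Subtype.ext ?_)
    rw [h, ← h0]
    simp
  map_unit := rfl

/-- `x ↦ (x, 1)` identifies `Ω` with the cross section `Σ_φ` of its order unit space. -/
theorem IsHilbertDomain.range_homogEmbed {Ω : Set Y} (hΩ : IsHilbertDomain Ω) :
    Set.range (homogEmbed (Ω := Ω)) = hΩ.orderUnitSpace.crossSection (homogState Ω) := by
  have hp := hΩ.nonempty.some_mem
  apply Set.Subset.antisymm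
  · rintro _ ⟨x, rfl⟩
    obtain ⟨δ, hδ, h⟩ := hΩ.exists_sub_smul_mem ⟨_, hp⟩ x
    refine ⟨⟨δ, hδ, fun w hw => ?_⟩, rfl⟩
    obtain ⟨s, hs, hs1, hs2⟩ :=
      hΩ.exists_unit_bound ⟨hΩ.nonempty.some, hp⟩ (w - homogEmbed x)
    have hne : {r : ℝ | 0 < r ∧ (w - homogEmbed x) + r • hΩ.orderUnitSpace.unit ∈
        hΩ.orderUnitSpace.cone ∧ r • hΩ.orderUnitSpace.unit - (w - homogEmbed x) ∈
        hΩ.orderUnitSpace.cone}.Nonempty :=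
      Set.nonempty_of_mem (x := s) (by
        refine ⟨hs, ?_, hs2⟩
        rw [add_comm]
        exact hs1)
    obtain ⟨r, ⟨hr, h1, -⟩, hrδ⟩ := exists_lt_of_csInf_lt hne hw
    have h3 := hΩ.smul_mem_homogCone (hΩ.homogEmbed_mem ⟨_, hp⟩) (sub_nonneg.2 hrδ.le)
    have h4 := add_mem (add_mem h1 h) h3
    change w ∈ hΩ.homogCone
    have h5 : w = w - homogEmbed x + r • homogEmbed ⟨_, hp⟩ +
      (homogEmbed x - δ • homogEmbed ⟨_, hp⟩) + (δ - r) • homogEmbed ⟨_, hp⟩ := by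
      module
    rw [h5]
    exact h4
  · rintro w ⟨⟨ε, hε, hw⟩, h1⟩
    set u : homogSpace Ω := homogEmbed ⟨_, hp⟩ with hu
    obtain ⟨s, hs, hs1, hs2⟩ := hΩ.exists_unit_bound ⟨_, hp⟩ (w - u)
    set c : ℝ := ε / (2 * s) with hc
    have hcpos : 0 < c := by positivity
    have hmem : w + c • (w - u) ∈ hΩ.homogCone := by
      have e1 : w + c • (w - u) - w + (c * s) • u = c • (s • u + (w - u)) := by module
      have e2 : (c * s) • u - (w + c • (w - u) - w) = c • (s • u - (w - u)) := by module
      have hin : c * s ∈ {r : ℝ | 0 < r ∧ w + c • (w - u) - w + r • hΩ.orderUnitSpace.unit ∈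
          hΩ.orderUnitSpace.cone ∧ r • hΩ.orderUnitSpace.unit - (w + c • (w - u) - w) ∈
          hΩ.orderUnitSpace.cone} := by
        refine ⟨by positivity, ?_, ?_⟩
        · change w + c • (w - u) - w + (c * s) • u ∈ hΩ.homogCone
          rw [e1]
          exact hΩ.smul_mem_homogCone hs1 hcpos.le
        · change (c * s) • u - (w + c • (w - u) - w) ∈ hΩ.homogCone
          rw [e2]
          exact hΩ.smul_mem_homogCone hs2 hcpos.le
      refine hw _ (lt_of_le_of_lt (csInf_le ⟨0, fun _ h => h.1.le⟩ hin) ?_)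
      have : c * s = ε / 2 := by rw [hc]; field_simp
      rw [this]
      linarith
    obtain ⟨r, hr, y, hy, he⟩ := hΩ.mem_homogCone.1 hmem
    have hw2 : (w : Y × ℝ).2 = 1 := h1
    have hr1 : r = 1 := by
      have := congrArg Prod.snd he
      simp [hw2, hu, homogEmbed] at this
      exact this.symm
    have hy1 : (w : Y × ℝ).1 + c • ((w : Y × ℝ).1 - hΩ.nonempty.some) = y := by
      have := congrArg Prod.fst he
      simpa [hr1, hu, homogEmbed] using this
    have hwΩ : (w : Y × ℝ).1 ∈ Ω := by
      have h1c : (1 + c) ≠ 0 := by positivity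
      refine hy _ hp ⟨c / (1 + c), 1 / (1 + c), by positivity, by positivity,
        by field_simp; ring, ?_⟩
      rw [← hy1]
      have : (w : Y × ℝ).1 = ((1 / (1 + c)) * (1 + c)) • (w : Y × ℝ).1 := by
        rw [one_div_mul_cancel h1c, one_smul]
      conv_rhs => rw [this]
      module
    exact ⟨⟨_, hwΩ⟩, Subtype.ext (Prod.ext rfl hw2.symm)⟩

/-- The Hilbert geometry on `Ω` is strictly convex, boundary points being taken for the
order unit norm. -/
def IsHilbertDomain.IsStrictlyConvex {Ω : Set Y} (hΩ : IsHilbertDomain Ω) : Prop :=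
  hΩ.orderUnitSpace.IsStrictlyConvex (homogState Ω)

end Homogenization

/-- `f : Ω₁ → Ω₂` is a projective linear homomorphism: there is a bi-positive linear map `T`
between the order unit spaces of `Ω₁` and `Ω₂` with `f = [T]`, where `[z] = z / φ₂(z)` and the
points `x` of `Ωᵢ` are the points `(x, 1)` of `Σ_φᵢ`. -/
def IsProjectiveLinearHom {Y₁ Y₂ : Type*} [AddCommGroup Y₁] [Module ℝ Y₁] [AddCommGroup Y₂]
    [Module ℝ Y₂] {Ω₁ : Set Y₁} {Ω₂ : Set Y₂} (h₁ : IsHilbertDomain Ω₁)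
    (h₂ : IsHilbertDomain Ω₂) (f : Ω₁ → Ω₂) : Prop :=
  ∃ T : homogSpace Ω₁ →ₗ[ℝ] homogSpace Ω₂,
    h₁.orderUnitSpace.BiPositive h₂.orderUnitSpace T ∧
    ∀ x : Ω₁, homogEmbed (f x) =
      (homogState Ω₂ (T (homogEmbed x)))⁻¹ • T (homogEmbed x)

/-! Over the open cone of `Ω`, Hilbert's metric is minus the logarithm of `crossRatio`, so an
isometry gives a map between open cones, defined up to positive scalars, that preserves
`crossRatio`. Linearity must be extracted from this alone.

Collinearity comes from equality in the triangle inequality. If `y` lies metrically between `x` and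
`z`, then `x - a y`, `a (y - b z)` and their sum are all boundary points, with `a = ratio x y` and
`b = ratio y z`. Strict convexity puts the two summands on one ray, so `y` is in the span of `x` and
`z` (`exists_comb_of_crossRatio_eq_mul`). Only strict convexity of the target enters: images of
collinear points are collinear.

Within the plane of two points the cone is a sector bounded by two linear forms, and the cross
ratios of a point with the two given points fix the quotient of these forms
(`mul_eq_mul_of_min_div_max`). Choosing the scalars so that `ratio` from a fixed `x` is preserved,
the map becomes linear on each plane through `x` (`rescale_comb`).

For additivity on `y`, `v` independent of `x`, the image of `y + v` is a combination of the images
of `y` and `v` with unknown coefficients. Splitting `x + y + v` as `(x + y) + v` and as `(x + v) +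
y` forces both coefficients to be 1 (`rescale_add`). Differences then extend the map to the whole
space, and bi-positivity passes to the closed cone, which is the set of recession directions of the
open one. -/

/-! ### Ratios and cross ratios in an algebraically open cone -/

namespace ConvexCone

variable {V : Type*} [AddCommGroup V] [Module ℝ V]

/-- The largest multiple of `y` that lies below `x` in the order of the closure of `K`. -/
noncomputable def ratio (K : ConvexCone ℝ V) (x y : V) : ℝ := sSup {s : ℝ | x - s • y ∈ K}

/-- The product of the two ratios; minus its logarithm is Hilbert's projective metric. -/
noncomputable def crossRatio (K : ConvexCone ℝ V) (x y : V) : ℝ := K.ratio x y * K.ratio y x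

/-- `p` is a direction of recession of `K`; for an algebraically open cone this means that `p`
lies in its closure. -/
def IsRecession (K : ConvexCone ℝ V) (p : V) : Prop := ∀ z ∈ K, z + p ∈ K

/-- `K` is algebraically open and its closure contains no line. -/
structure IsOpenSalient (K : ConvexCone ℝ V) : Prop where
  exists_sub_mem : ∀ x ∈ K, ∀ v, ∃ ε : ℝ, 0 < ε ∧ x - ε • v ∈ K
  eq_zero : ∀ p, K.IsRecession p → K.IsRecession (-p) → p = 0
  zero_notMem : (0 : V) ∉ K

/-- Sums of boundary points of `K` are interior unless the points lie on one ray. -/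
def IsStrict (K : ConvexCone ℝ V) : Prop :=
  ∀ p q, K.IsRecession p → K.IsRecession q → p ∉ K → q ∉ K → p + q ∉ K →
    p = 0 ∨ ∃ c : ℝ, 0 ≤ c ∧ q = c • p

theorem isRecession_of_mem {K : ConvexCone ℝ V} {x : V} (hx : x ∈ K) : K.IsRecession x :=
  fun _ hz => K.add_mem hz hx

theorem ratio_eq {K : ConvexCone ℝ V} {x y : V} {c : ℝ}
    (h : ∀ s : ℝ, x - s • y ∈ K ↔ s < c) : K.ratio x y = c := by
  have : {s : ℝ | x - s • y ∈ K} = Set.Iio c := by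
    ext s; exact h s
  rw [ratio, this, csSup_Iio]

theorem crossRatio_comm (K : ConvexCone ℝ V) (x y : V) : K.crossRatio x y = K.crossRatio y x :=
  mul_comm _ _

namespace IsOpenSalient

variable {K : ConvexCone ℝ V} (hK : K.IsOpenSalient) {x y z v : V}
include hK

theorem smul_mem_iff (hx : x ∈ K) {r : ℝ} : r • x ∈ K ↔ 0 < r := by
  refine ⟨fun h => ?_, fun h => K.smul_mem h hx⟩
  by_contra hr
  rcases (not_lt.1 hr).eq_or_lt with rfl | hr
  · exact hK.zero_notMem (by simpa using h)
  · have := K.add_mem h (K.smul_mem (neg_pos.2 hr) hx)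
    exact hK.zero_notMem (by simpa [← add_smul] using this)

/-- The admissible `s` form a down-set, since `y ∈ K`. It is bounded because the cone closure
contains no line, and it omits its supremum because `K` is algebraically open. -/
theorem sub_smul_mem_iff (hx : x ∈ K) (hy : y ∈ K) {s : ℝ} :
    x - s • y ∈ K ↔ s < K.ratio x y := by
  have hmono : ∀ s t : ℝ, s < t → x - t • y ∈ K → x - s • y ∈ K := by
    intro s t hst ht
    have := K.add_mem ht (K.smul_mem (sub_pos.2 hst) hy)
    convert this using 1
    module
  have hbdd : BddAbove {s : ℝ | x - s • y ∈ K} := by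
    by_contra hb
    have hall : ∀ s : ℝ, x - s • y ∈ K := by
      intro s
      obtain ⟨t, ht, hst⟩ := not_bddAbove_iff.1 hb s
      exact hmono s t hst ht
    have : y = 0 := by
      refine hK.eq_zero y (isRecession_of_mem hy) fun z hz => ?_
      obtain ⟨ε, hε, h⟩ := hK.exists_sub_mem z hz x
      -- The sum is `z - y`, so `-y` would be a recession direction as well as `y`.
      have h2 := K.add_mem h (K.smul_mem hε (hall ε⁻¹))
      convert h2 using 1
      rw [smul_sub, smul_smul, mul_inv_cancel₀ hε.ne']
      module
    exact hK.zero_notMem (this ▸ hy)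
  constructor
  · intro h
    obtain ⟨ε, hε, h2⟩ := hK.exists_sub_mem _ h y
    have : s + ε ≤ K.ratio x y := le_csSup hbdd (by
      change x - (s + ε) • y ∈ K
      convert h2 using 1
      module)
    linarith
  · intro h
    have hne : {s : ℝ | x - s • y ∈ K}.Nonempty := ⟨0, by simpa using hx⟩
    obtain ⟨t, ht, hst⟩ := exists_lt_of_lt_csSup hne h
    exact hmono s t hst ht

theorem ratio_pos (hx : x ∈ K) (hy : y ∈ K) : 0 < K.ratio x y :=
  (hK.sub_smul_mem_iff hx hy).1 (by simpa using hx)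

theorem isRecession_sub_ratio (hx : x ∈ K) (hy : y ∈ K) :
    K.IsRecession (x - K.ratio x y • y) := by
  intro z hz
  obtain ⟨ε, hε, h⟩ := hK.exists_sub_mem z hz y
  have h2 := K.add_mem h ((hK.sub_smul_mem_iff hx hy (s := K.ratio x y - ε)).2 (by linarith))
  convert h2 using 1
  module

theorem sub_ratio_notMem (hx : x ∈ K) (hy : y ∈ K) : x - K.ratio x y • y ∉ K := fun h =>
  lt_irrefl _ ((hK.sub_smul_mem_iff hx hy).1 h)

theorem ratio_smul_right (hx : x ∈ K) (hy : y ∈ K) {c : ℝ} (hc : 0 < c) :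
    K.ratio x (c • y) = K.ratio x y / c :=
  ratio_eq fun s => by rw [smul_smul, hK.sub_smul_mem_iff hx hy, lt_div_iff₀ hc]

theorem ratio_smul_left (hx : x ∈ K) (hy : y ∈ K) {c : ℝ} (hc : 0 < c) :
    K.ratio (c • x) y = c * K.ratio x y :=
  ratio_eq fun s => by
    have e : c • x - s • y = c • (x - (s / c) • y) := by
      rw [smul_sub, smul_smul, mul_div_cancel₀ _ hc.ne']
    have hi : c • (x - (s / c) • y) ∈ K ↔ x - (s / c) • y ∈ K :=
      ⟨fun h => by
        have := K.smul_mem (inv_pos.2 hc) h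
        rwa [smul_smul, inv_mul_cancel₀ hc.ne', one_smul] at this, fun h => K.smul_mem hc h⟩
    rw [e, hi, hK.sub_smul_mem_iff hx hy, div_lt_iff₀' hc]

theorem ratio_self (hx : x ∈ K) : K.ratio x x = 1 :=
  ratio_eq fun s => by
    have e : x - s • x = (1 - s) • x := by module
    rw [e, hK.smul_mem_iff hx, sub_pos]

theorem crossRatio_self_smul (hx : x ∈ K) {c : ℝ} (hc : 0 < c) :
    K.crossRatio x (c • x) = 1 := by
  rw [crossRatio, hK.ratio_smul_left hx hx hc, hK.ratio_smul_right hx hx hc, hK.ratio_self hx]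
  field_simp

theorem crossRatio_smul_smul (hx : x ∈ K) (hy : y ∈ K) {r s : ℝ} (hr : 0 < r) (hs : 0 < s) :
    K.crossRatio (r • x) (s • y) = K.crossRatio x y := by
  have hrx := K.smul_mem hr hx
  have hsy := K.smul_mem hs hy
  rw [crossRatio, crossRatio, hK.ratio_smul_left hx hsy hr, hK.ratio_smul_right hx hy hs,
    hK.ratio_smul_left hy hrx hs, hK.ratio_smul_right hy hx hr]
  field_simp

theorem crossRatio_pos (hx : x ∈ K) (hy : y ∈ K) : 0 < K.crossRatio x y :=
  mul_pos (hK.ratio_pos hx hy) (hK.ratio_pos hy hx)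

/-- With `a`, `b` the two ratios, `(x - a y) + a (y - b x) = (1 - a b) x` is a recession direction.
So `a b > 1` would put 0 in `K`, and `a b = 1` makes `x - a y` a recession direction of both signs,
hence zero. -/
theorem crossRatio_lt_one_or (hx : x ∈ K) (hy : y ∈ K) :
    K.crossRatio x y < 1 ∨ ∃ c : ℝ, 0 < c ∧ y = c • x := by
  have ha := hK.ratio_pos hx hy
  have hb := hK.ratio_pos hy hx
  have hp := hK.isRecession_sub_ratio hx hy
  have hq := hK.isRecession_sub_ratio hy hx
  rw [crossRatio]
  set a := K.ratio x y
  set b := K.ratio y x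
  have hab : a * b ≤ 1 := by
    by_contra h
    push Not at h
    have h1 := hp _ (K.smul_mem (sub_pos.2 h) hx)
    have h2 := hq _ (K.smul_mem (inv_pos.2 ha) h1)
    refine hK.zero_notMem ?_
    convert h2 using 1
    simp only [smul_add, smul_sub, smul_smul]
    rw [inv_mul_cancel₀ ha.ne']
    have : a⁻¹ * (a * b - 1) = b - a⁻¹ := by field_simp
    rw [this]
    module
  rcases hab.lt_or_eq with h | h
  · exact Or.inl h
  · right
    have h0 := hK.eq_zero _ hp (by
      intro z hz
      have h2 := K.smul_mem ha (hq _ (K.smul_mem (inv_pos.2 ha) hz))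
      convert h2 using 1
      simp only [smul_add, smul_sub, smul_smul]
      rw [mul_inv_cancel₀ ha.ne', h]
      module)
    refine ⟨a⁻¹, inv_pos.2 ha, ?_⟩
    rw [sub_eq_zero.1 h0, smul_smul, inv_mul_cancel₀ ha.ne', one_smul]

theorem crossRatio_lt_one_of_ne (hx : x ∈ K) (hy : y ∈ K) (h : ∀ c : ℝ, y ≠ c • x) :
    K.crossRatio x y < 1 :=
  (hK.crossRatio_lt_one_or hx hy).resolve_right fun ⟨c, _, hc⟩ => h c hc

theorem ne_smul_of_crossRatio_lt_one (hx : x ∈ K) (hy : y ∈ K) (h : K.crossRatio x y < 1)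
    (c : ℝ) : y ≠ c • x := by
  rintro rfl
  rw [hK.crossRatio_self_smul hx ((hK.smul_mem_iff hx).1 hy)] at h
  exact lt_irrefl _ h

/-! ### The cone in the plane of two points -/

/-- The plane meets `K` in the sector whose edges pass through `y - b x` and `x - a y`. The two
forms vanish on these edges and equal 1 at `x`. -/
theorem comb_mem_iff (hx : x ∈ K) (hy : y ∈ K) (h : K.crossRatio x y < 1) (r s : ℝ) :
    r • x + s • y ∈ K ↔ 0 < r + s * K.ratio y x ∧ 0 < r + s / K.ratio x y := by
  have ha := hK.ratio_pos hx hy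
  have hb := hK.ratio_pos hy hx
  have h1 := fun t : ℝ => hK.sub_smul_mem_iff hx hy (s := t)
  have h2 := fun t : ℝ => hK.sub_smul_mem_iff hy hx (s := t)
  rw [crossRatio] at h
  set a := K.ratio x y
  set b := K.ratio y x
  have hba : b < 1 / a := by rw [lt_div_iff₀ ha]; linarith
  have hpos : ∀ {c : ℝ} {w : V}, 0 < c → (c • w ∈ K ↔ w ∈ K) := fun {c w} hc =>
    ⟨fun h => by
      have := K.smul_mem (inv_pos.2 hc) h
      rwa [smul_smul, inv_mul_cancel₀ hc.ne', one_smul] at this, fun h => K.smul_mem hc h⟩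
  rcases lt_or_ge 0 r with hr | hr
  · have e : r • x + s • y = r • (x - (-s / r) • y) := by
      rw [smul_sub, smul_smul, mul_div_cancel₀ _ hr.ne']; module
    rw [e, hpos hr, h1, div_lt_iff₀ hr]
    have h3 : -s < a * r ↔ 0 < r + s / a := by
      rw [show r + s / a = (a * r + s) / a by field_simp, div_pos_iff_of_pos_right ha]
      constructor <;> intro h <;> linarith
    rw [h3]
    refine ⟨fun h => ⟨?_, h⟩, fun h => h.2⟩
    rcases le_total 0 s with hs | hs
    · positivity
    · have : s * (1 / a) ≤ s * b := mul_le_mul_of_nonpos_left hba.le hs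
      rw [mul_one_div] at this
      linarith
  · rcases lt_or_ge 0 s with hs | hs
    · have e : r • x + s • y = s • (y - (-r / s) • x) := by
        rw [smul_sub, smul_smul, mul_div_cancel₀ _ hs.ne']; module
      rw [e, hpos hs, h2, div_lt_iff₀ hs]
      have h3 : s * b < s * (1 / a) := mul_lt_mul_of_pos_left hba hs
      rw [mul_one_div] at h3
      constructor
      · intro h; constructor <;> linarith
      · rintro ⟨h, -⟩; linarith
    · have hn : ¬ (0 < r + s * b) := by nlinarith
      refine ⟨fun h => absurd ?_ hK.zero_notMem, fun h => absurd h.1 hn⟩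
      -- With both coefficients nonpositive, adding back `-r x` and `-s y` would put 0 in `K`.
      have h3 : ∀ {w : V} {t : ℝ}, w ∈ K → t ≤ 0 → K.IsRecession (-t • w) := by
        intro w t hw ht
        rcases ht.eq_or_lt with rfl | ht
        · intro z hz; simpa using hz
        · exact isRecession_of_mem (K.smul_mem (neg_pos.2 ht) hw)
      have := h3 hy hs _ (h3 hx hr _ h)
      convert this using 1
      module

theorem ratio_comb_right (hx : x ∈ K) (hy : y ∈ K) (h : K.crossRatio x y < 1) {r s : ℝ}
    (hv : r • x + s • y ∈ K) : K.ratio x (r • x + s • y) =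
      (max (r + s * K.ratio y x) (r + s / K.ratio x y))⁻¹ := by
  obtain ⟨hA, hB⟩ := (hK.comb_mem_iff hx hy h r s).1 hv
  refine ratio_eq fun t => ?_
  have e : x - t • (r • x + s • y) = (1 - t * r) • x + (-(t * s)) • y := by module
  rw [e, hK.comb_mem_iff hx hy h]
  have e1 : 1 - t * r + -(t * s) * K.ratio y x = 1 - t * (r + s * K.ratio y x) := by ring
  have e2 : 1 - t * r + -(t * s) / K.ratio x y = 1 - t * (r + s / K.ratio x y) := by ring
  rw [e1, e2, ← one_div, lt_div_iff₀ (lt_max_of_lt_left hA), sub_pos, sub_pos]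
  rcases lt_or_ge 0 t with ht | ht
  · rw [mul_max_of_nonneg _ _ ht.le, max_lt_iff]
  · constructor
    · intro _; nlinarith [lt_max_of_lt_left (b := r + s * K.ratio y x) (c := r + s / K.ratio x y) hA]
    · intro _; constructor <;> nlinarith

theorem ratio_comb_left (hx : x ∈ K) (hy : y ∈ K) (h : K.crossRatio x y < 1) (r s : ℝ) :
    K.ratio (r • x + s • y) x = min (r + s * K.ratio y x) (r + s / K.ratio x y) := by
  refine ratio_eq fun t => ?_
  have e : (r • x + s • y) - t • x = (r - t) • x + s • y := by module
  rw [e, hK.comb_mem_iff hx hy h, lt_min_iff]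
  constructor <;> rintro ⟨h1, h2⟩ <;> constructor <;> linarith

theorem crossRatio_comb (hx : x ∈ K) (hy : y ∈ K) (h : K.crossRatio x y < 1) {r s : ℝ}
    (hv : r • x + s • y ∈ K) : K.crossRatio x (r • x + s • y) =
      min (r + s * K.ratio y x) (r + s / K.ratio x y) /
        max (r + s * K.ratio y x) (r + s / K.ratio x y) := by
  rw [crossRatio, hK.ratio_comb_right hx hy h hv, hK.ratio_comb_left hx hy h, mul_comm,
    ← div_eq_mul_inv]

/-- At `y` the two forms take the values `b` and `1 / a`. Dividing by these values and clearing a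
common factor `b` weights the second form by `a b`, the cross ratio of `x` and `y`. -/
theorem crossRatio_comb' (hx : x ∈ K) (hy : y ∈ K) (h : K.crossRatio x y < 1) {r s : ℝ}
    (hv : r • x + s • y ∈ K) : K.crossRatio y (r • x + s • y) =
      min (K.crossRatio x y * (r + s / K.ratio x y)) (r + s * K.ratio y x) /
        max (K.crossRatio x y * (r + s / K.ratio x y)) (r + s * K.ratio y x) := by
  have ha := hK.ratio_pos hx hy
  have hb := hK.ratio_pos hy hx
  rw [add_comm (r • x)] at hv ⊢
  rw [hK.crossRatio_comb hy hx (by rwa [crossRatio_comm]) hv, crossRatio]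
  have e1 : K.ratio x y * K.ratio y x * (r + s / K.ratio x y) =
      K.ratio y x * (s + r * K.ratio x y) := by field_simp; ring
  have e2 : r + s * K.ratio y x = K.ratio y x * (s + r / K.ratio y x) := by field_simp; ring
  rw [e1, e2, ← mul_min_of_nonneg _ _ hb.le, ← mul_max_of_nonneg _ _ hb.le,
    mul_div_mul_left _ _ hb.ne']

/-- For nonnegative coefficients the forms satisfy `D B ≤ A ≤ B`, with `D` the cross ratio of `x`
and `y`, so the two factors are `A / B` and `D B / A`. -/
theorem crossRatio_eq_mul_of_between (hx : x ∈ K) (hy : y ∈ K) (h : K.crossRatio x y < 1)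
    {r s : ℝ} (hr : 0 ≤ r) (hs : 0 ≤ s) (hv : r • x + s • y ∈ K) :
    K.crossRatio x y = K.crossRatio x (r • x + s • y) * K.crossRatio (r • x + s • y) y := by
  have ha := hK.ratio_pos hx hy
  have hb := hK.ratio_pos hy hx
  obtain ⟨hA, hB⟩ := (hK.comb_mem_iff hx hy h r s).1 hv
  have h' := h
  rw [crossRatio] at h'
  have h1 : r + s * K.ratio y x ≤ r + s / K.ratio x y := by
    have : K.ratio y x ≤ 1 / K.ratio x y := by rw [le_div_iff₀ ha]; linarith
    have := mul_le_mul_of_nonneg_left this hs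
    rw [mul_one_div] at this
    linarith
  have h2 : K.crossRatio x y * (r + s / K.ratio x y) ≤ r + s * K.ratio y x := by
    have : K.crossRatio x y * (r + s / K.ratio x y) =
        K.ratio x y * K.ratio y x * r + s * K.ratio y x := by
      rw [crossRatio]; field_simp
    rw [this]
    nlinarith
  rw [crossRatio_comm K (r • x + s • y) y, hK.crossRatio_comb hx hy h hv, hK.crossRatio_comb' hx hy h hv,
    min_eq_left h1, max_eq_right h1, min_eq_left h2, max_eq_right h2]
  generalize r + s / K.ratio x y = B at hB
  generalize r + s * K.ratio y x = A at hA
  field_simp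

/-! ### The triangle inequality and its equality case -/

theorem mul_ratio_le (hx : x ∈ K) (hy : y ∈ K) (hz : z ∈ K) :
    K.ratio x y * K.ratio y z ≤ K.ratio x z := by
  by_contra! hlt
  have ha := hK.ratio_pos hx hy
  have hb := hK.ratio_pos hy hz
  have h1 := hK.isRecession_sub_ratio hx hy
  have h2 := (hK.sub_smul_mem_iff hy hz (s := K.ratio x z / K.ratio x y)).2 (by
    rw [div_lt_iff₀ ha]; linarith)
  have h3 := h1 _ (K.smul_mem ha h2)
  refine lt_irrefl _ ((hK.sub_smul_mem_iff hx hz (s := K.ratio x z)).1 ?_)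
  convert h3 using 1
  rw [smul_sub, smul_smul, mul_div_cancel₀ _ ha.ne']
  module

theorem exists_comb_of_crossRatio_eq_mul (hs : K.IsStrict) (hx : x ∈ K) (hy : y ∈ K)
    (hz : z ∈ K) (h : K.crossRatio x z = K.crossRatio x y * K.crossRatio y z) :
    ∃ α β : ℝ, y = α • x + β • z := by
  have ha := hK.ratio_pos hx hy
  have hb := hK.ratio_pos hy hz
  have h1 := hK.mul_ratio_le hx hy hz
  have h2 := hK.mul_ratio_le hz hy hx
  -- The cross ratio identity is the product of two one-sided inequalities between positive numbers,
  -- so each is an equality.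
  have heq : K.ratio x z = K.ratio x y * K.ratio y z := by
    refine le_antisymm ?_ h1
    have h3 := hK.ratio_pos hz hy
    have h4 := hK.ratio_pos hy hx
    simp only [crossRatio] at h
    have h5 : K.ratio x z * (K.ratio z y * K.ratio y x) ≤
        (K.ratio x y * K.ratio y z) * (K.ratio z y * K.ratio y x) := by
      calc _ ≤ K.ratio x z * K.ratio z x :=
            mul_le_mul_of_nonneg_left h2 (hK.ratio_pos hx hz).le
        _ = _ := by rw [h]; ring
    exact le_of_mul_le_mul_right h5 (mul_pos h3 h4)
  have hp := hK.isRecession_sub_ratio hx hy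
  have hq := hK.isRecession_sub_ratio hy hz
  have hp' := hK.sub_ratio_notMem hx hy
  have hq' := hK.sub_ratio_notMem hy hz
  have hpq := hK.sub_ratio_notMem hx hz
  rw [heq] at hpq
  set a := K.ratio x y
  set b := K.ratio y z
  have hrec : K.IsRecession (a • (y - b • z)) := fun w hw => by
    have := K.smul_mem ha (hq _ (K.smul_mem (inv_pos.2 ha) hw))
    rwa [smul_add, smul_smul, mul_inv_cancel₀ ha.ne', one_smul] at this
  have hnot : a • (y - b • z) ∉ K := fun hm => by
    have := K.smul_mem (inv_pos.2 ha) hm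
    rw [smul_smul, inv_mul_cancel₀ ha.ne', one_smul] at this
    exact hq' this
  have hsum : x - a • y + a • (y - b • z) ∉ K := by
    convert hpq using 2
    module
  -- Two boundary points have the boundary point `x - a b z` as sum. Strictness puts them on one
  -- ray, and that relation is solved for `y`.
  rcases hs _ _ hp hrec hp' hnot hsum with h0 | ⟨c, hc, h0⟩
  · exact ⟨a⁻¹, 0, by
      rw [sub_eq_zero.1 h0, smul_smul, inv_mul_cancel₀ ha.ne']; module⟩
  · have hca : 0 < a + c * a := by positivity
    refine ⟨(a + c * a)⁻¹ * c, (a + c * a)⁻¹ * (a * b), ?_⟩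
    have h3 : (a + c * a) • y = c • x + (a * b) • z := by
      have : (a + c * a) • y - (c • x + (a * b) • z) =
        a • (y - b • z) - c • (x - a • y) := by module
      rw [← sub_eq_zero, this, h0, sub_self]
    rw [mul_smul, mul_smul, ← smul_add, ← h3, smul_smul, inv_mul_cancel₀ hca.ne', one_smul]

end IsOpenSalient

end ConvexCone

/-! ### Maps preserving cross ratios: collinearity -/

namespace ConvexCone

variable {V V' : Type*} [AddCommGroup V] [Module ℝ V] [AddCommGroup V'] [Module ℝ V']

/-- `f` rescaled so that it becomes linear on the lines through `x`, if it preserves cross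
ratios. -/
noncomputable def rescale (K : ConvexCone ℝ V) (K' : ConvexCone ℝ V') (f : V → V') (x v : V) :
    V' :=
  (K'.ratio (f x) (f v) / K.ratio x v) • f v

/-- `f` maps `K` to `K'` and preserves cross ratios. -/
structure IsCrossRatioHom (K : ConvexCone ℝ V) (K' : ConvexCone ℝ V') (f : V → V') : Prop where
  isOpenSalient : K.IsOpenSalient
  isOpenSalient' : K'.IsOpenSalient
  isStrict : K'.IsStrict
  map_mem : ∀ x ∈ K, f x ∈ K'
  map_crossRatio : ∀ x ∈ K, ∀ y ∈ K, K'.crossRatio (f x) (f y) = K.crossRatio x y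

/-- The first equation gives `t' / w'` up to inversion. If it were inverted, the second would force
`t = w` or `k² = 1`; the latter is impossible, and in the former inversion changes nothing. -/
theorem mul_eq_mul_of_min_div_max {k t w t' w' : ℝ} (hk : 0 < k) (hk1 : k < 1) (ht : 0 < t)
    (hw : 0 < w) (ht' : 0 < t') (hw' : 0 < w')
    (h1 : min t' w' / max t' w' = min t w / max t w)
    (h2 : min (k * w') t' / max (k * w') t' = min (k * w) t / max (k * w) t) :
    t' * w = t * w' := by
  have hkw : 0 < k * w := by positivity
  have hkw' : 0 < k * w' := by positivity
  have hkk : k * k < 1 := by nlinarith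
  rcases le_total t w with a | a <;> rcases le_total t' w' with b | b <;>
  rcases le_total (k * w) t with c | c <;> rcases le_total (k * w') t' with d | d <;>
  simp only [min_eq_left, min_eq_right, max_eq_left, max_eq_right, a, b, c, d] at h1 h2 <;>
  rw [div_eq_div_iff (by positivity) (by positivity)] at h1 h2 <;>
  nlinarith [mul_pos ht ht', mul_pos hw hw', mul_pos ht hw', mul_pos hw ht']

namespace IsCrossRatioHom

variable {K : ConvexCone ℝ V} {K' : ConvexCone ℝ V'} {f : V → V'}
  (hf : IsCrossRatioHom K K' f) {x y z v w : V}
include hf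

theorem crossRatio_lt_one (hx : x ∈ K) (hy : y ∈ K) (h : K.crossRatio x y < 1) :
    K'.crossRatio (f x) (f y) < 1 := by
  rwa [hf.map_crossRatio x hx y hy]

theorem map_smul (hx : x ∈ K) {c : ℝ} (hc : 0 < c) : ∃ d : ℝ, 0 < d ∧ f (c • x) = d • f x := by
  have hcx := K.smul_mem hc hx
  refine (hf.isOpenSalient'.crossRatio_lt_one_or (hf.map_mem x hx)
    (hf.map_mem _ hcx)).resolve_left ?_
  rw [hf.map_crossRatio x hx _ hcx, hf.isOpenSalient.crossRatio_self_smul hx hc]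
  exact lt_irrefl _

theorem exists_map_between (hx : x ∈ K) (hy : y ∈ K) (h : K.crossRatio x y < 1) {r s : ℝ}
    (hr : 0 ≤ r) (hs : 0 ≤ s) (hv : r • x + s • y ∈ K) :
    ∃ α β : ℝ, f (r • x + s • y) = α • f x + β • f y := by
  refine hf.isOpenSalient'.exists_comb_of_crossRatio_eq_mul hf.isStrict (hf.map_mem _ hx)
    (hf.map_mem _ hv) (hf.map_mem _ hy) ?_
  rw [hf.map_crossRatio _ hx _ hy, hf.map_crossRatio _ hx _ hv, hf.map_crossRatio _ hv _ hy]
  exact hf.isOpenSalient.crossRatio_eq_mul_of_between hx hy h hr hs hv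

/-- Here `x` lies between the new point and `y`. The between case expresses `f x` through the other
two images, and the relation can be inverted because `f x` and `f y` are not proportional. -/
theorem exists_map_comb_of_neg (hx : x ∈ K) (hy : y ∈ K) (h : K.crossRatio x y < 1) {r s : ℝ}
    (hs : s < 0) (hv : r • x + s • y ∈ K) :
    ∃ α β : ℝ, f (r • x + s • y) = α • f x + β • f y := by
  have hK := hf.isOpenSalient
  have hr : 0 < r := by
    have := ((hK.comb_mem_iff hx hy h r s).1 hv).2
    have h2 := div_neg_of_neg_of_pos hs (hK.ratio_pos hx hy)
    linarith
  have hxe : r⁻¹ • (r • x + s • y) + (-s / r) • y = x := by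
    rw [smul_add, smul_smul, smul_smul, inv_mul_cancel₀ hr.ne', add_assoc, ← add_smul]
    have : r⁻¹ * s + -s / r = 0 := by field_simp; ring
    rw [this]; module
  have hne := hK.ne_smul_of_crossRatio_lt_one hy hx (by rwa [crossRatio_comm])
  have hlt : K.crossRatio (r • x + s • y) y < 1 := by
    rw [crossRatio_comm]
    refine hK.crossRatio_lt_one_of_ne hy hv fun c hc => ?_
    refine hne (r⁻¹ * c + -s / r) ?_
    rw [← hxe, hc]
    module
  obtain ⟨α, β, hαβ⟩ := hf.exists_map_between hv hy hlt (inv_nonneg.2 hr.le)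
    (div_nonneg (neg_nonneg.2 hs.le) hr.le) (by rwa [hxe])
  rw [hxe] at hαβ
  have hα : α ≠ 0 := by
    rintro rfl
    refine hf.isOpenSalient'.ne_smul_of_crossRatio_lt_one (hf.map_mem _ hy) (hf.map_mem _ hx)
      (hf.crossRatio_lt_one hy hx (by rwa [crossRatio_comm])) β ?_
    rw [hαβ]; module
  refine ⟨α⁻¹, -(α⁻¹ * β), ?_⟩
  rw [hαβ, smul_add, smul_smul, inv_mul_cancel₀ hα]
  module

theorem exists_map_comb (hx : x ∈ K) (hy : y ∈ K) (h : K.crossRatio x y < 1) {r s : ℝ}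
    (hv : r • x + s • y ∈ K) : ∃ α β : ℝ, f (r • x + s • y) = α • f x + β • f y := by
  rcases lt_or_ge s 0 with hs | hs
  · exact hf.exists_map_comb_of_neg hx hy h hs hv
  rcases lt_or_ge r 0 with hr | hr
  · rw [add_comm] at hv ⊢
    obtain ⟨α, β, hαβ⟩ := hf.exists_map_comb_of_neg hy hx (by rwa [crossRatio_comm]) hr hv
    exact ⟨β, α, by rw [hαβ, add_comm]⟩
  · exact hf.exists_map_between hx hy h hr hs hv

/-! ### Linearity of the rescaled map on planes through a point -/

theorem rescale_smul_self (hx : x ∈ K) {c : ℝ} (hc : 0 < c) :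
    rescale K K' f x (c • x) = c • f x := by
  obtain ⟨d, hd, h⟩ := hf.map_smul hx hc
  have hfx := hf.map_mem x hx
  rw [rescale, h, hf.isOpenSalient.ratio_smul_right hx hx hc,
    hf.isOpenSalient'.ratio_smul_right hfx hfx hd, hf.isOpenSalient.ratio_self hx,
    hf.isOpenSalient'.ratio_self hfx, smul_smul]
  congr 1
  field_simp

theorem rescale_self (hx : x ∈ K) : rescale K K' f x x = f x := by
  simpa using hf.rescale_smul_self hx one_pos

theorem rescale_smul (hx : x ∈ K) (hv : v ∈ K) {c : ℝ} (hc : 0 < c) :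
    rescale K K' f x (c • v) = c • rescale K K' f x v := by
  obtain ⟨d, hd, h⟩ := hf.map_smul hv hc
  have hfx := hf.map_mem x hx
  rw [rescale, rescale, h, hf.isOpenSalient.ratio_smul_right hx hv hc,
    hf.isOpenSalient'.ratio_smul_right hfx (hf.map_mem v hv) hd, smul_smul, smul_smul]
  congr 1
  have := (hf.isOpenSalient.ratio_pos hx hv).ne'
  field_simp

/-- Rescaling preserves the ratio from `x` to `y`, and equality of cross ratios then preserves the
ratio back. The sectors in source and target are thus cut out by the same two forms. -/
theorem rescale_comb_of_lt_one (hx : x ∈ K) (hy : y ∈ K) (h : K.crossRatio x y < 1) (r s : ℝ) :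
    (r • f x + s • rescale K K' f x y ∈ K' ↔ r • x + s • y ∈ K) ∧
    (r • x + s • y ∈ K →
      rescale K K' f x (r • x + s • y) = r • f x + s • rescale K K' f x y) := by
  have hK := hf.isOpenSalient
  have hK' := hf.isOpenSalient'
  have hfx := hf.map_mem x hx
  have hfy := hf.map_mem y hy
  have hD := hf.map_crossRatio x hx y hy
  have h' := hf.crossRatio_lt_one hx hy h
  have ha := hK.ratio_pos hx hy
  have hb := hK.ratio_pos hy hx
  have ha' := hK'.ratio_pos hfx hfy
  have hb' := hK'.ratio_pos hfy hfx
  have hDe : K'.ratio (f x) (f y) * K'.ratio (f y) (f x) = K.ratio x y * K.ratio y x := hD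
  constructor
  · rw [rescale, smul_smul, hK'.comb_mem_iff hfx hfy h', hK.comb_mem_iff hx hy h]
    have e1 : s * (K'.ratio (f x) (f y) / K.ratio x y) * K'.ratio (f y) (f x) =
        s * K.ratio y x := by
      field_simp
      linear_combination s * hDe
    have e2 : s * (K'.ratio (f x) (f y) / K.ratio x y) / K'.ratio (f x) (f y) =
        s / K.ratio x y := by
      field_simp
    rw [e1, e2]
  · intro hv
    obtain ⟨r', s', hv'⟩ := hf.exists_map_comb hx hy h hv
    have hfv := hf.map_mem _ hv
    have hD1 := hf.map_crossRatio x hx _ hv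
    have hD2 := hf.map_crossRatio y hy _ hv
    rw [hv'] at hfv hD1 hD2
    obtain ⟨hA, hB⟩ := (hK.comb_mem_iff hx hy h r s).1 hv
    obtain ⟨hA', hB'⟩ := (hK'.comb_mem_iff hfx hfy h' r' s').1 hfv
    rw [hK.crossRatio_comb hx hy h hv, hK'.crossRatio_comb hfx hfy h' hfv] at hD1
    rw [hK.crossRatio_comb' hx hy h hv, hK'.crossRatio_comb' hfx hfy h' hfv, hD] at hD2
    have hprop := mul_eq_mul_of_min_div_max (hK.crossRatio_pos hx hy) h hA hB hA' hB' hD1 hD2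
    have hR := hK.ratio_comb_right hx hy h hv
    have hR' := hK'.ratio_comb_right hfx hfy h' hfv
    rw [rescale, rescale, hv', hR, hR']
    rw [crossRatio] at h
    set a := K.ratio x y
    set b := K.ratio y x
    set a' := K'.ratio (f x) (f y)
    set b' := K'.ratio (f y) (f x)
    -- Both target forms are the source forms times one factor `c`, which the rescaling of the image
    -- point cancels.
    obtain ⟨c, hc, hcA, hcB⟩ : ∃ c : ℝ, 0 < c ∧ r' + s' * b' = c * (r + s * b) ∧
        r' + s' / a' = c * (r + s / a) := by
      refine ⟨(r' + s' * b') / (r + s * b), by positivity, ?_, ?_⟩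
      · field_simp
      · rw [div_mul_eq_mul_div, eq_div_iff hA.ne']
        linear_combination -hprop
    -- Subtracting the two forms eliminates `r'`; the remaining coefficient is nonzero because `a b
    -- < 1`.
    have hs' : s' = c * (s * (a' / a)) := by
      have e : (1 - a * b) * s' = (1 - a * b) * (c * (s * (a' / a))) := by
        have e3 : s' - a' * b' * s' = a' * (c * (r + s / a) - c * (r + s * b)) := by
          rw [← hcA, ← hcB]; field_simp; ring
        rw [hDe] at e3
        calc (1 - a * b) * s' = s' - a * b * s' := by ring
          _ = _ := by rw [e3]; field_simp; ring
      exact mul_left_cancel₀ (by linarith) e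
    have hr' : r' = c * r := by
      have : s' / a' = c * (s / a) := by rw [hs']; field_simp
      rw [this] at hcB
      linarith
    rw [hcA, hcB, ← mul_max_of_nonneg _ _ hc.le, hs', hr']
    have hm : 0 < max (r + s * b) (r + s / a) := lt_max_of_lt_left hA
    have e : (c * max (r + s * b) (r + s / a))⁻¹ / (max (r + s * b) (r + s / a))⁻¹ = c⁻¹ := by
      field_simp
    rw [e, smul_add, smul_smul, smul_smul, smul_smul, inv_mul_cancel_left₀ hc.ne',
      inv_mul_cancel_left₀ hc.ne']

theorem rescale_comb_mem_iff (hx : x ∈ K) (hy : y ∈ K) (r s : ℝ) :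
    r • f x + s • rescale K K' f x y ∈ K' ↔ r • x + s • y ∈ K := by
  rcases hf.isOpenSalient.crossRatio_lt_one_or hx hy with h | ⟨c, hc, rfl⟩
  · exact (hf.rescale_comb_of_lt_one hx hy h r s).1
  · rw [hf.rescale_smul_self hx hc, smul_smul, smul_smul, ← add_smul, ← add_smul,
      hf.isOpenSalient.smul_mem_iff hx, hf.isOpenSalient'.smul_mem_iff (hf.map_mem x hx)]

theorem rescale_comb (hx : x ∈ K) (hy : y ∈ K) {r s : ℝ} (hv : r • x + s • y ∈ K) :
    rescale K K' f x (r • x + s • y) = r • f x + s • rescale K K' f x y := by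
  rcases hf.isOpenSalient.crossRatio_lt_one_or hx hy with h | ⟨c, hc, rfl⟩
  · exact (hf.rescale_comb_of_lt_one hx hy h r s).2 hv
  · rw [hf.rescale_smul_self hx hc, smul_smul, smul_smul, ← add_smul, ← add_smul] at *
    exact hf.rescale_smul_self hx ((hf.isOpenSalient.smul_mem_iff hx).1 hv)

theorem rescale_eq_smul (hx : x ∈ K) (hv : v ∈ K) :
    ∃ c : ℝ, 0 < c ∧ rescale K K' f x v = c • f v :=
  ⟨_, div_pos (hf.isOpenSalient'.ratio_pos (hf.map_mem x hx) (hf.map_mem v hv))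
    (hf.isOpenSalient.ratio_pos hx hv), rfl⟩

/-- Linearity on the plane of `x` and `y` gives a point of that plane whose image is proportional to
`f v`. The cross ratio of that point and `v` is then 1, so they are proportional. This gives
independence of images in `rescale_add`. -/
theorem exists_comb_of_map_eq (hx : x ∈ K) (hy : y ∈ K) (hv : v ∈ K) {r s : ℝ}
    (h : f v = r • f x + s • f y) : ∃ α β : ℝ, v = α • x + β • y := by
  obtain ⟨c, hc, hcy⟩ := hf.rescale_eq_smul hx hy
  have hmem : r • x + (s / c) • y ∈ K := by
    rw [← hf.rescale_comb_mem_iff hx hy, hcy, smul_smul, div_mul_cancel₀ _ hc.ne', ← h]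
    exact hf.map_mem v hv
  have hr := hf.rescale_comb hx hy hmem
  rw [hcy, smul_smul, div_mul_cancel₀ _ hc.ne', ← h] at hr
  obtain ⟨d, hd, hd'⟩ := hf.rescale_eq_smul hx hmem
  rw [hd'] at hr
  rcases hf.isOpenSalient.crossRatio_lt_one_or hmem hv with hlt | ⟨e, he, hev⟩
  · rw [← hf.map_crossRatio _ hmem _ hv, ← hr,
      hf.isOpenSalient'.crossRatio_self_smul (hf.map_mem _ hmem) hd] at hlt
    exact absurd hlt (lt_irrefl _)
  · exact ⟨e * r, e * (s / c), by rw [hev]; module⟩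

/-! ### Additivity and linear extension -/

/-- Rescalings at `x` and at `y` differ by a positive scalar at each point, so additivity of the
rescaling at `y` survives with unknown coefficients. -/
theorem exists_rescale_add (hx : x ∈ K) (hy : y ∈ K) (hv : v ∈ K) :
    ∃ α β : ℝ, rescale K K' f x (y + v) = α • rescale K K' f x y + β • rescale K K' f x v := by
  have hyv : (1 : ℝ) • y + (1 : ℝ) • v ∈ K := by simpa using K.add_mem hy hv
  have h := hf.rescale_comb hy hv hyv
  simp only [one_smul] at h hyv
  obtain ⟨c, hc, h1⟩ := hf.rescale_eq_smul hx hy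
  obtain ⟨d, hd, h2⟩ := hf.rescale_eq_smul hx hv
  obtain ⟨e, he, h3⟩ := hf.rescale_eq_smul hx hyv
  obtain ⟨g, hg, h4⟩ := hf.rescale_eq_smul hy hyv
  obtain ⟨k, hk, h5⟩ := hf.rescale_eq_smul hy hv
  rw [h4, h5] at h
  have h6 : f (y + v) = g⁻¹ • (f y + k • f v) := by
    rw [← h, smul_smul, inv_mul_cancel₀ hg.ne', one_smul]
  refine ⟨e * g⁻¹ * c⁻¹, e * g⁻¹ * k * d⁻¹, ?_⟩
  rw [h1, h2, h3, h6, smul_smul, smul_smul, inv_mul_cancel_right₀ hc.ne', smul_smul,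
    inv_mul_cancel_right₀ hd.ne']
  module

theorem rescale_add_self (hx : x ∈ K) (hv : v ∈ K) :
    rescale K K' f x (x + v) = f x + rescale K K' f x v := by
  have h := hf.rescale_comb hx hv (r := 1) (s := 1) (by simpa using K.add_mem hx hv)
  simpa using h

theorem rescale_add (hx : x ∈ K) (hy : y ∈ K) (hv : v ∈ K) :
    rescale K K' f x (y + v) = rescale K K' f x y + rescale K K' f x v := by
  have hyv := K.add_mem hy hv
  have hfx := hf.map_mem x hx
  rcases hf.isOpenSalient.crossRatio_lt_one_or hx hy with h | ⟨c, hc, rfl⟩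
  swap
  · have h := hf.rescale_comb hx hv (r := c) (s := 1) (by simpa using hyv)
    simpa [hf.rescale_smul_self hx hc] using h
  by_cases hdep : ∃ r s : ℝ, v = r • x + s • y
  · obtain ⟨r, s, rfl⟩ := hdep
    have e : y + (r • x + s • y) = r • x + (1 + s) • y := by module
    rw [e] at hyv ⊢
    rw [hf.rescale_comb hx hy hyv, hf.rescale_comb hx hy hv]
    module
  have hind : ∀ α β γ : ℝ, α • f x + β • rescale K K' f x y + γ • rescale K K' f x v = 0 →
      α = 0 ∧ β = 0 ∧ γ = 0 := by
    intro α β γ h0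
    obtain ⟨c, hc, hcy⟩ := hf.rescale_eq_smul hx hy
    obtain ⟨d, hd, hdv⟩ := hf.rescale_eq_smul hx hv
    rw [hcy, hdv] at h0
    have hγ : γ = 0 := by
      by_contra hγ
      refine hdep (hf.exists_comb_of_map_eq hx hy hv
        (r := -(γ * d)⁻¹ * α) (s := -(γ * d)⁻¹ * (β * c)) ?_)
      have hγd : γ * d ≠ 0 := mul_ne_zero hγ hd.ne'
      have h1 : (γ * d) • f v = -(α • f x + (β * c) • f y) := by
        rw [eq_neg_iff_add_eq_zero, ← h0]; module
      calc f v = (γ * d)⁻¹ • ((γ * d) • f v) := by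
            rw [smul_smul, inv_mul_cancel₀ hγd, one_smul]
        _ = _ := by rw [h1]; module
    subst hγ
    have hβ : β = 0 := by
      by_contra hβ
      refine hf.isOpenSalient'.ne_smul_of_crossRatio_lt_one hfx (hf.map_mem y hy)
        (hf.crossRatio_lt_one hx hy h) (-(β * c)⁻¹ * α) ?_
      have hβc : β * c ≠ 0 := mul_ne_zero hβ hc.ne'
      have h1 : (β * c) • f y = -(α • f x) := by
        rw [eq_neg_iff_add_eq_zero, ← h0]; module
      calc f y = (β * c)⁻¹ • ((β * c) • f y) := by
            rw [smul_smul, inv_mul_cancel₀ hβc, one_smul]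
        _ = _ := by rw [h1]; module
    subst hβ
    refine ⟨?_, rfl, rfl⟩
    by_contra hα
    have h1 : α • f x = 0 := by rw [← h0]; module
    rcases smul_eq_zero.1 h1 with h2 | h2
    · exact hα h2
    · exact hf.isOpenSalient'.zero_notMem (h2 ▸ hfx)
  obtain ⟨α, β, h1⟩ := hf.exists_rescale_add hx hy hv
  obtain ⟨γ, δ, h2⟩ := hf.exists_rescale_add hx (K.add_mem hx hy) hv
  obtain ⟨γ', δ', h3⟩ := hf.exists_rescale_add hx (K.add_mem hx hv) hy
  rw [hf.rescale_add_self hx hy, add_assoc, hf.rescale_add_self hx hyv, h1] at h2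
  rw [hf.rescale_add_self hx hv, add_assoc, add_comm v y, hf.rescale_add_self hx hyv, h1] at h3
  -- Comparing coefficients of `f x` gives `γ = 1`, and those of the image of `y` give `α = γ`. The
  -- other splitting yields `β` likewise.
  have i2 := hind (1 - γ) (α - γ) (β - δ) (by rw [← sub_eq_zero] at h2; rw [← h2]; module)
  have i3 := hind (1 - γ') (α - δ') (β - γ') (by rw [← sub_eq_zero] at h3; rw [← h3]; module)
  have hα : α = 1 := by linarith [i2.1, i2.2.1]
  have hβ : β = 1 := by linarith [i3.1, i3.2.2]
  rw [h1, hα, hβ, one_smul, one_smul]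

theorem exists_linearMap (hne : ∃ u, u ∈ K) : ∃ T : V →ₗ[ℝ] V',
    (∀ v, T v ∈ K' ↔ v ∈ K) ∧ ∀ v ∈ K, ∃ c : ℝ, 0 < c ∧ T v = c • f v := by
  obtain ⟨u, hu⟩ := hne
  set F := rescale K K' f u with hF
  have hadd : ∀ {y v : V}, y ∈ K → v ∈ K → F (y + v) = F y + F v := fun hy hv =>
    hf.rescale_add hu hy hv
  have hsm : ∀ {v : V} {c : ℝ}, v ∈ K → 0 < c → F (c • v) = c • F v := fun hv hc =>
    hf.rescale_smul hu hv hc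
  have habs : ∀ v : V, ∃ t : ℝ, 0 < t ∧ v + t • u ∈ K := fun v => by
    obtain ⟨ε, hε, h⟩ := hf.isOpenSalient.exists_sub_mem u hu (-v)
    refine ⟨ε⁻¹, inv_pos.2 hε, ?_⟩
    have h2 := K.smul_mem (inv_pos.2 hε) h
    rw [smul_sub, smul_neg, smul_neg, smul_smul, inv_mul_cancel₀ hε.ne', one_smul] at h2
    convert h2 using 1
    module
  choose t ht htm using habs
  -- The difference formula does not depend on the shift, so sums and multiples may use whichever
  -- shift is convenient.
  have key : ∀ (v : V) (s : ℝ), 0 < s → v + s • u ∈ K →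
      F (v + t v • u) - t v • F u = F (v + s • u) - s • F u := by
    intro v s hs hsm'
    have h1 := hadd (htm v) (K.smul_mem hs hu)
    have h2 := hadd hsm' (K.smul_mem (ht v) hu)
    rw [hsm hu hs] at h1
    rw [hsm hu (ht v)] at h2
    have e : v + t v • u + s • u = v + s • u + t v • u := by module
    rw [e, h2] at h1
    rw [sub_eq_sub_iff_add_eq_add, h1]
  let T : V →ₗ[ℝ] V' :=
    { toFun := fun v => F (v + t v • u) - t v • F u
      map_add' := fun v w => by
        have e : v + w + (t v + t w) • u = (v + t v • u) + (w + t w • u) := by module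
        rw [key (v + w) (t v + t w) (add_pos (ht v) (ht w))
          (by rw [e]; exact K.add_mem (htm v) (htm w)), e, hadd (htm v) (htm w)]
        module
      map_smul' := fun c v => by
        change F (c • v + t (c • v) • u) - t (c • v) • F u = c • (F (v + t v • u) - t v • F u)
        have hpos : ∀ (c : ℝ) (v : V), 0 < c →
            F (c • v + t (c • v) • u) - t (c • v) • F u =
              c • (F (v + t v • u) - t v • F u) := by
          intro c v hc
          have e : c • v + (c * t v) • u = c • (v + t v • u) := by module
          rw [key (c • v) (c * t v) (mul_pos hc (ht v))
            (by rw [e]; exact K.smul_mem hc (htm v)), e, hsm (htm v) hc]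
          module
        have hzero : F ((0 : V) + t 0 • u) - t 0 • F u = 0 := by
          rw [zero_add, hsm hu (ht 0), sub_self]
        have hneg : ∀ v : V, F (-v + t (-v) • u) - t (-v) • F u =
            -(F (v + t v • u) - t v • F u) := by
          intro v
          have h1 := hadd (htm v) (htm (-v))
          have e : v + t v • u + (-v + t (-v) • u) = (t v + t (-v)) • u := by module
          rw [e, hsm hu (add_pos (ht v) (ht (-v)))] at h1
          rw [← sub_eq_zero] at h1 ⊢
          rw [← neg_eq_zero, ← h1]
          module
        rcases lt_trichotomy c 0 with hc | rfl | hc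
        · have e : c • v = -((-c) • v) := by module
          rw [e, hneg, hpos (-c) v (by linarith)]
          module
        · simpa using hzero
        · exact hpos c v hc }
  have hT : ∀ v ∈ K, T v = F v := fun v hv => by
    change F (v + t v • u) - t v • F u = F v
    rw [hadd hv (K.smul_mem (ht v) hu), hsm hu (ht v), add_sub_cancel_right]
  have hFu : F u = f u := hf.rescale_self hu
  refine ⟨T, fun v => ?_, fun v hv => ?_⟩
  · have h := hf.rescale_comb_mem_iff hu (htm v) (-t v) 1
    have e : -t v • u + (1 : ℝ) • (v + t v • u) = v := by module
    rw [e] at h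
    rw [← h]
    change F (v + t v • u) - t v • F u ∈ K' ↔ _
    rw [hFu, one_smul, neg_smul, neg_add_eq_sub]
  · rw [hT v hv]
    exact hf.rescale_eq_smul hu hv

end IsCrossRatioHom

end ConvexCone

/-! ### The open cone over a Hilbert domain -/

namespace IsHilbertDomain

variable {Y : Type*} [AddCommGroup Y] [Module ℝ Y] {Ω : Set Y} (hΩ : IsHilbertDomain Ω)

/-- The interior of the cone of `Ω`: the positive multiples of `Ω × {1}`. -/
def openCone : ConvexCone ℝ (homogSpace Ω) where
  carrier := {w | ∃ r : ℝ, 0 < r ∧ ∃ x : Ω, w = r • homogEmbed x}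
  smul_mem' := by
    rintro c hc _ ⟨r, hr, x, rfl⟩
    exact ⟨c * r, mul_pos hc hr, x, smul_smul _ _ _⟩
  add_mem' := by
    rintro _ ⟨r, hr, x, rfl⟩ _ ⟨s, hs, y, rfl⟩
    have h : 0 < r + s := add_pos hr hs
    refine ⟨r + s, h, ⟨(r / (r + s)) • (x : Y) + (s / (r + s)) • (y : Y),
      hΩ.convex x.2 y.2 (by positivity) (by positivity) (by field_simp)⟩, ?_⟩
    ext
    · simp only [homogEmbed, Submodule.coe_add, Submodule.coe_smul, Prod.fst_add, Prod.smul_fst,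
        smul_add, smul_smul]
      rw [mul_div_cancel₀ _ h.ne', mul_div_cancel₀ _ h.ne']
    · simp [homogEmbed]

theorem homogEmbed_mem_openCone (x : Ω) : homogEmbed x ∈ hΩ.openCone :=
  ⟨1, one_pos, x, (one_smul _ _).symm⟩

theorem homogState_homogEmbed (x : Ω) : homogState Ω (homogEmbed x) = 1 := rfl

theorem mem_openCone_of_state {w : homogSpace Ω} (h : 0 < homogState Ω w)
    (hw : (homogState Ω w)⁻¹ • (w : Y × ℝ).1 ∈ Ω) : w ∈ hΩ.openCone := by
  refine ⟨homogState Ω w, h, ⟨_, hw⟩, ?_⟩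
  ext
  · simp [homogEmbed, smul_smul, h.ne']
  · simp [homogEmbed, homogState]

theorem mem_openCone_iff {w : homogSpace Ω} : w ∈ hΩ.openCone ↔
    0 < homogState Ω w ∧ (homogState Ω w)⁻¹ • (w : Y × ℝ).1 ∈ Ω := by
  refine ⟨?_, fun h => hΩ.mem_openCone_of_state h.1 h.2⟩
  rintro ⟨r, hr, x, rfl⟩
  have e : homogState Ω (r • homogEmbed x) = r := by simp [homogState_homogEmbed]
  rw [e]
  refine ⟨hr, ?_⟩
  simp [homogEmbed, smul_smul, hr.ne']

theorem comb_mem_openCone_iff (x y : Ω) (t : ℝ) :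
    (1 - t) • homogEmbed x + t • homogEmbed y ∈ hΩ.openCone ↔
      AffineMap.lineMap (x : Y) (y : Y) t ∈ Ω := by
  have e : homogState Ω ((1 - t) • homogEmbed x + t • homogEmbed y) = 1 := by
    simp [homogState_homogEmbed]
  rw [mem_openCone_iff, e, AffineMap.lineMap_apply_module]
  simp [homogEmbed]

theorem openCone_le_homogCone {w : homogSpace Ω} (hw : w ∈ hΩ.openCone) : w ∈ hΩ.homogCone := by
  obtain ⟨r, hr, x, rfl⟩ := hw
  exact hΩ.smul_mem_homogCone (hΩ.homogEmbed_mem x) hr.le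

/-- Adding a closure point to a point of the open cone gives a multiple of a point on an open
segment into the closure. Conversely a recession direction `w` has `ε u + w` in the cone for all `ε
> 0`, and the Archimedean property applies. -/
theorem mem_homogCone_iff_isRecession {w : homogSpace Ω} :
    w ∈ hΩ.homogCone ↔ hΩ.openCone.IsRecession w := by
  constructor
  · rintro ⟨r, hr, y, hy, hw⟩ _ ⟨s, hs, x, rfl⟩
    rcases hr.eq_or_lt with rfl | hr
    · have : w = 0 := Subtype.ext (by rw [hw]; simp)
      rw [this, add_zero]
      exact ⟨s, hs, x, rfl⟩
    have e : homogState Ω (s • homogEmbed x + w) = s + r := by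
      simp [homogState, homogEmbed, hw]
    refine hΩ.mem_openCone_of_state (by rw [e]; positivity) ?_
    rw [e]
    refine hy x x.2 ⟨s / (s + r), r / (s + r), by positivity, by positivity, by field_simp, ?_⟩
    simp only [homogEmbed, Submodule.coe_add, Submodule.coe_smul, hw, Prod.fst_add,
      Prod.smul_fst]
    rw [div_eq_inv_mul, div_eq_inv_mul]
    module
  · intro h
    have := hΩ.homogCone_archimedean ⟨_, hΩ.nonempty.some_mem⟩ (-w) fun ε hε => by
      rw [sub_neg_eq_add]
      exact hΩ.openCone_le_homogCone (h _ (hΩ.openCone.smul_mem hε (hΩ.homogEmbed_mem_openCone _)))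
    simpa using this

theorem isOpenSalient_openCone : hΩ.openCone.IsOpenSalient where
  exists_sub_mem := by
    rintro _ ⟨s, hs, x, rfl⟩ v
    obtain ⟨r, hr, -, h⟩ := hΩ.exists_unit_bound x v
    -- Half of `s x` absorbs the perturbation, since `r x - v` is in the closed cone; the other half
    -- keeps the result in the open cone.
    refine ⟨s / (2 * r), by positivity, ?_⟩
    have h1 := hΩ.smul_mem_homogCone h (c := s / (2 * r)) (by positivity)
    have h2 := hΩ.mem_homogCone_iff_isRecession.1 h1 _
      (hΩ.openCone.smul_mem (half_pos hs) (hΩ.homogEmbed_mem_openCone x))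
    convert h2 using 1
    rw [smul_sub, smul_smul]
    have e : s / (2 * r) * r = s / 2 := by field_simp
    rw [e]
    module
  eq_zero := fun p hp hp' => hΩ.orderUnitSpace.salient p
    (hΩ.mem_homogCone_iff_isRecession.2 hp) (hΩ.mem_homogCone_iff_isRecession.2 hp')
  zero_notMem := by
    intro h
    have := (hΩ.mem_openCone_iff.1 h).1
    simp at this

theorem norm_smul_lt (v : homogSpace Ω) {ε : ℝ} (hε : 0 < ε) :
    ∃ δ : ℝ, 0 < δ ∧ ∀ t : ℝ, 0 ≤ t → t < δ → hΩ.orderUnitSpace.norm (t • v) < ε := by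
  obtain ⟨r, hr, h1, h2⟩ := hΩ.exists_unit_bound ⟨_, hΩ.nonempty.some_mem⟩ v
  set u : homogSpace Ω := homogEmbed ⟨_, hΩ.nonempty.some_mem⟩ with hu
  have hum : u ∈ hΩ.homogCone := hΩ.homogEmbed_mem _
  refine ⟨ε / (2 * r), by positivity, fun t ht htδ => ?_⟩
  have h3 : t * r ≤ ε / 2 := by
    rw [lt_div_iff₀ (by positivity)] at htδ
    linarith
  have h4 := hΩ.smul_mem_homogCone hum (sub_nonneg.2 h3)
  refine lt_of_le_of_lt (csInf_le ⟨0, fun _ h => h.1.le⟩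
    (⟨half_pos hε, ?_, ?_⟩ : ε / 2 ∈ {r : ℝ | 0 < r ∧ t • v + r • u ∈ hΩ.homogCone ∧
      r • u - t • v ∈ hΩ.homogCone})) (by linarith)
  · convert add_mem (hΩ.smul_mem_homogCone h1 ht) h4 using 1
    module
  · convert add_mem (hΩ.smul_mem_homogCone h2 ht) h4 using 1
    module

/-- Moving `w` slightly towards the unit enters the cross section, while `w` itself serves as the
nearby point outside it. -/
theorem mem_boundary {w : homogSpace Ω} (h1 : homogState Ω w = 1) (hw : w ∈ hΩ.homogCone)
    (hw' : w ∉ hΩ.openCone) : w ∈ hΩ.orderUnitSpace.boundary (homogState Ω) := by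
  refine ⟨h1, fun ε hε => ⟨?_, w, h1, ?_, ?_⟩⟩
  · set u : homogSpace Ω := homogEmbed ⟨_, hΩ.nonempty.some_mem⟩ with hu
    obtain ⟨δ, hδ, h⟩ := hΩ.norm_smul_lt (u - w) hε
    set t := min (δ / 2) (1 / 2) with ht
    have ht0 : 0 < t := by positivity
    have htδ : t < δ := lt_of_le_of_lt (min_le_left _ _) (by linarith)
    have ht1 : t < 1 := lt_of_le_of_lt (min_le_right _ _) (by norm_num)
    refine ⟨t • u + (1 - t) • w, ?_, ?_⟩
    · rw [← hΩ.range_homogEmbed]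
      have hm := hΩ.mem_homogCone_iff_isRecession.1
        (hΩ.smul_mem_homogCone hw (sub_nonneg.2 ht1.le)) _
        (hΩ.openCone.smul_mem ht0 (hΩ.homogEmbed_mem_openCone ⟨_, hΩ.nonempty.some_mem⟩))
      obtain ⟨r, hr, x, hx⟩ := hm
      have e : r = 1 := by
        have := congrArg (homogState Ω) hx
        simpa [homogState_homogEmbed, h1] using this.symm
      refine ⟨x, ?_⟩
      rw [hx, e, one_smul]
    · have e : t • u + (1 - t) • w - w = t • (u - w) := by module
      rw [e]
      exact h t ht0.le htδ
  · rw [← hΩ.range_homogEmbed]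
    rintro ⟨x, rfl⟩
    exact hw' (hΩ.homogEmbed_mem_openCone x)
  · obtain ⟨δ, hδ, h⟩ := hΩ.norm_smul_lt (0 : homogSpace Ω) hε
    simpa using h 0 le_rfl hδ

/-- Normalised by the state, nonzero boundary vectors become boundary points of the cross section,
and their sum is a positive multiple of a point of the open segment between these. -/
theorem isStrict_openCone (hsc : hΩ.IsStrictlyConvex) : hΩ.openCone.IsStrict := by
  intro p q hp hq hp' hq' hpq
  by_cases hp0 : p = 0
  · exact Or.inl hp0
  by_cases hq0 : q = 0
  · exact Or.inr ⟨0, le_rfl, by rw [hq0, zero_smul]⟩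
  right
  rw [← mem_homogCone_iff_isRecession] at hp hq
  have hr := hΩ.isStrictlyPositiveState.pos p hp hp0
  have hs := hΩ.isStrictlyPositiveState.pos q hq hq0
  set r := homogState Ω p with hr'
  set s := homogState Ω q with hs'
  have hbd : ∀ w : homogSpace Ω, w ∈ hΩ.homogCone → w ∉ hΩ.openCone → 0 < homogState Ω w →
      (homogState Ω w)⁻¹ • w ∈ hΩ.orderUnitSpace.boundary (homogState Ω) := by
    intro w hw hw' hpos
    refine hΩ.mem_boundary ?_ (hΩ.smul_mem_homogCone hw (inv_nonneg.2 hpos.le)) fun h => hw' ?_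
    · rw [map_smul, smul_eq_mul, inv_mul_cancel₀ hpos.ne']
    · simpa [smul_smul, hpos.ne'] using hΩ.openCone.smul_mem hpos h
  by_cases heq : r⁻¹ • p = s⁻¹ • q
  · refine ⟨s * r⁻¹, by positivity, ?_⟩
    rw [mul_smul, heq, smul_smul, mul_inv_cancel₀ hs.ne', one_smul]
  · exfalso
    have hsub := hsc _ (hbd p hp hp' hr) _ (hbd q hq hq' hs) heq
    have hm : (r / (r + s)) • (r⁻¹ • p) + (s / (r + s)) • (s⁻¹ • q) ∈
        openSegment ℝ (r⁻¹ • p) (s⁻¹ • q) :=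
      ⟨_, _, by positivity, by positivity, by field_simp, rfl⟩
    have h1 := hsub hm
    rw [← hΩ.range_homogEmbed] at h1
    obtain ⟨x, hx⟩ := h1
    refine hpq ⟨r + s, by positivity, x, ?_⟩
    rw [hx, smul_add, smul_smul, smul_smul, smul_smul, smul_smul]
    have e1 : (r + s) * (r / (r + s) * r⁻¹) = 1 := by field_simp
    have e2 : (r + s) * (s / (r + s) * s⁻¹) = 1 := by field_simp
    rw [mul_assoc, mul_assoc, e1, e2, one_smul, one_smul]

theorem ratio_homogEmbed_lt_one {x y : Ω} (hxy : x ≠ y) :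
    hΩ.openCone.ratio (homogEmbed x) (homogEmbed y) < 1 := by
  have hx := hΩ.homogEmbed_mem_openCone x
  have hy := hΩ.homogEmbed_mem_openCone y
  have hrec := hΩ.mem_homogCone_iff_isRecession.2
    (hΩ.isOpenSalient_openCone.isRecession_sub_ratio hx hy)
  set a := hΩ.openCone.ratio (homogEmbed x) (homogEmbed y)
  have hne : homogEmbed x - a • homogEmbed y ≠ 0 := by
    intro h0
    have h1 : a = 1 := by
      have := congrArg (homogState Ω) h0
      rw [map_sub, map_smul, homogState_homogEmbed, homogState_homogEmbed, map_zero, smul_eq_mul,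
        mul_one, sub_eq_zero] at this
      exact this.symm
    rw [h1, one_smul, sub_eq_zero] at h0
    exact hxy (Subtype.ext (congrArg (fun w : homogSpace Ω => (w : Y × ℝ).1) h0))
  have := hΩ.isStrictlyPositiveState.pos _ hrec hne
  rw [map_sub, map_smul, homogState_homogEmbed, homogState_homogEmbed, smul_eq_mul,
    mul_one] at this
  linarith

/-- In the coordinate `t` the sector's forms cut out the interval from `-a / (1 - a)` to `1 / (1 -
b)`, whose end-points contribute the factors `1 / a` and `1 / b`. -/
theorem hilbertDist_eq_neg_log (x y : Ω) : hilbertDist Ω (x : Y) (y : Y) =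
    -Real.log (hΩ.openCone.crossRatio (homogEmbed x) (homogEmbed y)) := by
  have hK := hΩ.isOpenSalient_openCone
  have hx := hΩ.homogEmbed_mem_openCone x
  have hy := hΩ.homogEmbed_mem_openCone y
  by_cases hxy : x = y
  · subst hxy
    have := hK.crossRatio_self_smul hx one_pos
    rw [one_smul] at this
    simp [hilbertDist, this]
  · have hxy' : (x : Y) ≠ y := fun h => hxy (Subtype.ext h)
    have ha := hK.ratio_pos hx hy
    have hb := hK.ratio_pos hy hx
    have ha1 := hΩ.ratio_homogEmbed_lt_one hxy
    have hb1 := hΩ.ratio_homogEmbed_lt_one (Ne.symm hxy)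
    have hlt : hΩ.openCone.crossRatio (homogEmbed x) (homogEmbed y) < 1 :=
      mul_lt_one_of_nonneg_of_lt_one_left ha.le ha1 hb1.le
    have hset : {t : ℝ | AffineMap.lineMap (x : Y) (y : Y) t ∈ Ω} =
        Set.Ioo (-(hΩ.openCone.ratio (homogEmbed x) (homogEmbed y)) /
          (1 - hΩ.openCone.ratio (homogEmbed x) (homogEmbed y)))
          (1 / (1 - hΩ.openCone.ratio (homogEmbed y) (homogEmbed x))) := by
      ext t
      rw [Set.mem_ofPred_eq, ← hΩ.comb_mem_openCone_iff, hK.comb_mem_iff hx hy hlt, Set.mem_Ioo,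
        div_lt_iff₀ (by linarith), lt_div_iff₀ (by linarith), and_comm]
      refine and_congr ?_ ?_
      · have e : 1 - t + t / hΩ.openCone.ratio (homogEmbed x) (homogEmbed y) =
            (t * (1 - hΩ.openCone.ratio (homogEmbed x) (homogEmbed y)) +
              hΩ.openCone.ratio (homogEmbed x) (homogEmbed y)) /
              hΩ.openCone.ratio (homogEmbed x) (homogEmbed y) := by
          field_simp; ring
        rw [e, div_pos_iff_of_pos_right ha]
        constructor <;> intro h <;> linarith
      · constructor <;> intro h <;> linarith
    rw [hilbertDist, if_neg hxy', hset, ConvexCone.crossRatio]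
    set a := hΩ.openCone.ratio (homogEmbed x) (homogEmbed y)
    set b := hΩ.openCone.ratio (homogEmbed y) (homogEmbed x)
    have hA : 0 < 1 - a := by linarith
    have hB : 0 < 1 - b := by linarith
    have hAB : -a / (1 - a) < 1 / (1 - b) :=
      (div_neg_of_neg_of_pos (neg_neg_of_pos ha) hA).trans (by positivity)
    simp only [csInf_Ioo hAB, csSup_Ioo hAB]
    have e1 : -a / (1 - a) - 1 = -(1 / (1 - a)) := by field_simp; ring
    have e2 : -a / (1 - a) - 0 = -(a / (1 - a)) := by ring
    have e3 : 1 / (1 - b) - 1 = b / (1 - b) := by field_simp; ring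
    rw [e1, e2, e3, sub_zero, abs_neg, abs_neg, abs_of_pos (by positivity),
      abs_of_pos (by positivity), abs_of_pos (by positivity), abs_of_pos (by positivity),
      ← Real.log_inv]
    congr 1
    field_simp

end IsHilbertDomain

/-! ### From the isometry to the bi-positive linear map -/

theorem theorem1p2 {Y₁ Y₂ : Type*} [AddCommGroup Y₁] [Module ℝ Y₁] [AddCommGroup Y₂]
    [Module ℝ Y₂] (Ω₁ : Set Y₁) (Ω₂ : Set Y₂)
    (hΩ₁ : IsHilbertDomain Ω₁) (hΩ₂ : IsHilbertDomain Ω₂)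
    (hsc₁ : hΩ₁.IsStrictlyConvex) (hsc₂ : hΩ₂.IsStrictlyConvex)
    (f : Ω₁ → Ω₂)
    (hf : ∀ x y : Ω₁, hilbertDist Ω₂ (f x : Y₂) (f y : Y₂) = hilbertDist Ω₁ (x : Y₁) (y : Y₁)) :
    IsProjectiveLinearHom hΩ₁ hΩ₂ f := by
  have hK₁ := hΩ₁.isOpenSalient_openCone
  have hK₂ := hΩ₂.isOpenSalient_openCone
  have hcross : ∀ x y : Ω₁, hΩ₂.openCone.crossRatio (homogEmbed (f x)) (homogEmbed (f y)) =
      hΩ₁.openCone.crossRatio (homogEmbed x) (homogEmbed y) := by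
    intro x y
    have h := hf x y
    rw [hΩ₁.hilbertDist_eq_neg_log, hΩ₂.hilbertDist_eq_neg_log, neg_inj] at h
    exact Real.log_injOn_pos
      (hK₂.crossRatio_pos (hΩ₂.homogEmbed_mem_openCone _) (hΩ₂.homogEmbed_mem_openCone _))
      (hK₁.crossRatio_pos (hΩ₁.homogEmbed_mem_openCone _) (hΩ₁.homogEmbed_mem_openCone _)) h
  classical
  -- `g` is constant along the rays of the open cone; its values off the cone, including the default
  -- 0, play no role.
  set g : homogSpace Ω₁ → homogSpace Ω₂ := fun w =>
    if h : (homogState Ω₁ w)⁻¹ • (w : Y₁ × ℝ).1 ∈ Ω₁ then homogEmbed (f ⟨_, h⟩) else 0 with hg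
  have hgs : ∀ (r : ℝ) (x : Ω₁), 0 < r → g (r • homogEmbed x) = homogEmbed (f x) := by
    intro r x hr
    have e : (homogState Ω₁ (r • homogEmbed x))⁻¹ • ((r • homogEmbed x : homogSpace Ω₁) :
        Y₁ × ℝ).1 = x := by
      rw [map_smul, IsHilbertDomain.homogState_homogEmbed]
      simp [homogEmbed, smul_smul, hr.ne']
    have hm : (homogState Ω₁ (r • homogEmbed x))⁻¹ • ((r • homogEmbed x : homogSpace Ω₁) :
        Y₁ × ℝ).1 ∈ Ω₁ := by rw [e]; exact x.2
    simp only [hg]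
    rw [dif_pos hm]
    congr 2
    exact Subtype.ext e
  have hhom : ConvexCone.IsCrossRatioHom hΩ₁.openCone hΩ₂.openCone g :=
    { isOpenSalient := hK₁
      isOpenSalient' := hK₂
      isStrict := hΩ₂.isStrict_openCone hsc₂
      map_mem := by
        rintro _ ⟨r, hr, x, rfl⟩
        rw [hgs r x hr]
        exact hΩ₂.homogEmbed_mem_openCone _
      map_crossRatio := by
        rintro _ ⟨r, hr, x, rfl⟩ _ ⟨s, hs, y, rfl⟩
        rw [hgs r x hr, hgs s y hs, hcross, hK₁.crossRatio_smul_smul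
          (hΩ₁.homogEmbed_mem_openCone x) (hΩ₁.homogEmbed_mem_openCone y) hr hs] }
  obtain ⟨T, hT, hTg⟩ := hhom.exists_linearMap
    ⟨_, hΩ₁.homogEmbed_mem_openCone ⟨_, hΩ₁.nonempty.some_mem⟩⟩
  refine ⟨T, fun w => ?_, fun x => ?_⟩
  · change T w ∈ hΩ₂.homogCone ↔ w ∈ hΩ₁.homogCone
    rw [hΩ₁.mem_homogCone_iff_isRecession, hΩ₂.mem_homogCone_iff_isRecession]
    constructor
    · intro h z hz
      rw [← hT, map_add]
      exact h _ ((hT z).2 hz)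
    · intro h z hz
      have hu := hΩ₁.homogEmbed_mem_openCone ⟨_, hΩ₁.nonempty.some_mem⟩
      set u : homogSpace Ω₁ := homogEmbed ⟨_, hΩ₁.nonempty.some_mem⟩
      -- As `T` need not be onto, `z` cannot be pulled back. Instead `z + T w` is split as `(z - ε T
      -- u) + T (ε u + w)`, both terms being in the open cone.
      obtain ⟨ε, hε, hz'⟩ := hK₂.exists_sub_mem z hz (T u)
      have h2 := hΩ₂.openCone.add_mem hz' ((hT _).2 (h _ (hΩ₁.openCone.smul_mem hε hu)))
      rw [map_add, map_smul] at h2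
      convert h2 using 1
      module
  · obtain ⟨c, hc, h⟩ := hTg _ (hΩ₁.homogEmbed_mem_openCone x)
    have hgx : g (homogEmbed x) = homogEmbed (f x) := by simpa using hgs 1 x one_pos
    rw [h, hgx, map_smul, IsHilbertDomain.homogState_homogEmbed, smul_eq_mul, mul_one, smul_smul,
      inv_mul_cancel₀ hc.ne', one_smul]
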